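/- Let $G$ be a $\sigma$-compact locally compact group, let $H$ be a complex Hilbert space with inner product $\langle\cdot,\cdot\rangle$ linear in the second argument, let $B(H)$ be the algebra of bounded linear operators on $H$, and let $\pi\colon G\to U(H)$ be a unitary representation that is continuous for the strong operator topology. A functional $\psi\colon B(H)\to\mathbb{C}$ is called $\pi$-invariant if $\psi(\pi(g)^{*}a\pi(g))=\psi(a)$ for all $g\in G$ and $a\in B(H)$. The representation $\pi$ is called amenable (in the sense of Bekka) if there is a $\pi$-invariant state on $B(H)$, i.e., a $\pi$-invariant positive linear form $\varphi\colon B(H)\to\mathbb{C}$ with $\varphi(1)=1$. A probability charge on the power set $\mathcal{P}(X)$ of a set $X$ is a map $\mu\colon\mathcal{P}(X)\to[0,1]$ with $\mu(X)=1$ and $\mu(A\cup B)=\mu(A)+\mu(B)$ for all disjoint $A,B\subseteq X$; bounded functions $f\colon X\to\mathbb{C}$ are integrated against $\mu$ as uniform limits of functions with finite range. Then $\pi$ is amenable if and only if there exist an orthonormal basis $X$ of $H$ and a probability charge $\mu$ on $\mathcal{P}(X)$ such that the functional \[ \mu_{\bullet}\colon B(H)\to\mathbb{C},\qquad \mu_{\bullet}(a)=\int_{X}\langle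 x,ax\rangle\,\mathrm{d}\mu(x) \] is $\pi$-invariant. -/

import Mathlib

open scoped ComplexOrder

/-- A probability charge on a Boolean algebra: a finitely additive map into `[0, 1]`
taking the value `1` at the top element. -/
structure ProbabilityCharge (B : Type*) [BooleanAlgebra B] where
  toFun : B → ℝ
  mem_Icc : ∀ A, toFun A ∈ Set.Icc (0 : ℝ) 1
  top_eq_one : toFun ⊤ = 1
  sup_eq_add : ∀ A C, A ⊓ C = ⊥ → toFun (A ⊔ C) = toFun A + toFun C

namespace ProbabilityCharge

instance {B : Type*} [BooleanAlgebra B] : CoeFun (ProbabilityCharge B) (fun _ => B → ℝ) :=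
  ⟨ProbabilityCharge.toFun⟩

variable {X : Type*}

/-- The integral `∑ y, y * μ {x | s x = y}` of a function `s` with finite range. Only the finitely
many values `y` of `s` contribute to the sum. -/
noncomputable def simpleIntegral (μ : ProbabilityCharge (Set X)) (s : X → ℝ) : ℝ :=
  ∑ᶠ y : ℝ, y * μ (s ⁻¹' {y})

/-- The integral of a bounded real function with respect to a charge on the full power set:
the supremum of the integrals of the finite-range functions below it. Since every subset of `X`
is in the domain of `μ`, a bounded function is a uniform limit of finite-range functions, and
this is the limit of their integrals. -/
noncomputable def integralReal (μ : ProbabilityCharge (Set X)) (f : X → ℝ) : ℝ :=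
  sSup {r : ℝ | ∃ s : X → ℝ, (Set.range s).Finite ∧ (∀ x, s x ≤ f x) ∧ r = μ.simpleIntegral s}

/-- The integral of a bounded complex function, by real and imaginary parts. -/
noncomputable def integral (μ : ProbabilityCharge (Set X)) (f : X → ℂ) : ℂ :=
  (μ.integralReal (fun x => (f x).re) : ℂ) + (μ.integralReal (fun x => (f x).im) : ℂ) * Complex.I

end ProbabilityCharge

section

variable {H : Type*} [NormedAddCommGroup H] [InnerProductSpace ℂ H] [CompleteSpace H]

/-- A set of vectors is an orthonormal basis of a Hilbert space if it is orthonormal and its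
linear span is dense. -/
def IsOrthonormalBasis (X : Set H) : Prop :=
  Orthonormal ℂ ((↑) : X → H) ∧ (Submodule.span ℂ X).topologicalClosure = ⊤

/-- The functional `a ↦ ∫ ⟪x, a x⟫ dμ(x)` on `B(H)` induced by a charge on the power set
of `X ⊆ H`. -/
noncomputable def inducedFunctional (X : Set H) (μ : ProbabilityCharge (Set X))
    (a : H →L[ℂ] H) : ℂ :=
  μ.integral (fun x : X => inner ℂ (x : H) (a (x : H)))

variable {G : Type*} [Group G]

/-- Continuity of a unitary representation for the strong operator topology. -/
def IsStronglyContinuous [TopologicalSpace G] (π : G →* unitary (H →L[ℂ] H)) : Prop :=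
  ∀ x : H, Continuous (fun g : G => (π g : H →L[ℂ] H) x)

/-- Invariance of a functional on `B(H)` under `a ↦ π(g)* a π(g)` for all `g`. -/
def IsRepInvariant (π : G →* unitary (H →L[ℂ] H)) (F : (H →L[ℂ] H) → ℂ) : Prop :=
  ∀ (g : G) (a : H →L[ℂ] H),
    F (star (π g : H →L[ℂ] H) * a * (π g : H →L[ℂ] H)) = F a

/-- Amenability of a unitary representation in the sense of Bekka: there is an invariant state,
that is, an invariant positive unital linear form, on `B(H)`. -/
def IsAmenableRep (π : G →* unitary (H →L[ℂ] H)) : Prop :=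
  ∃ φ : (H →L[ℂ] H) →ₚ[ℂ] ℂ, φ 1 = 1 ∧ IsRepInvariant π φ

end

/-! A charge on an orthonormal basis always induces a state (`inducedState`), so the work lies in
turning an invariant state φ into a charge. There are two cases.

If π has a nonzero finite-dimensional invariant subspace W, the normalised trace of the compression
to W is invariant, and it is given by uniform weights on an orthonormal basis of W
(`exists_invariant_charge_of_invariant_submodule`).

Otherwise every invariant state kills the finite rank operators. Its normal part is a positive
operator T of trace at most 1 that commutes with π, and if T were nonzero, the range of a suitable
function of T would be a finite-dimensional invariant subspace
(`exists_invariant_submodule_of_apply_rankOne_ne_zero`). Hahn–Banach separation in the predual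
(`exists_finiteRankState_norm_comp_lt`) replaces φ by convex combinations of vector states that are
almost invariant in norm. To make this uniform on compact sets, one composes with the average A of
conjugations against a continuous density on G: A absorbs small conjugations in norm, and φ ∘ A is
again an invariant state (`apply_repAverage_conjAct`).

The crux is that almost invariant states are diagonal in different bases, while a single basis is
wanted. Since φ ∘ A kills finite rank projections, the approximants can be made almost zero on the
projection onto any finite-dimensional V, then compressed to the complement of V and diagonalised
there (`exists_orthonormal_almost_invariant`). Doing this along a compact exhaustion of G, with V
the span of all earlier vectors, gives mutually orthogonal families. Their union extends to a basis,
and an ultrafilter limit of the weights is the charge (`exists_basis_invariant_charge`). -/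

open Filter Topology MeasureTheory

/-! ### Integration against a finitely additive charge. -/

namespace ProbabilityCharge

section

variable {X : Type*} (μ : ProbabilityCharge (Set X))

lemma nonneg (A : Set X) : 0 ≤ μ A := (μ.mem_Icc A).1

lemma map_univ : μ Set.univ = 1 := μ.top_eq_one

lemma map_union {A C : Set X} (h : Disjoint A C) : μ (A ∪ C) = μ A + μ C :=
  μ.sup_eq_add A C (disjoint_iff.1 h)

lemma map_empty : μ ∅ = 0 := by
  have := μ.map_union (disjoint_bot_left : Disjoint (∅ : Set X) ∅)
  simpa using this

lemma map_preimage_finset {ι : Type*} [DecidableEq ι] (p : X → ι) (F : Finset ι) :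
    μ (p ⁻¹' F) = ∑ i ∈ F, μ (p ⁻¹' {i}) := by
  induction F using Finset.induction_on with
  | empty => simp [map_empty]
  | insert a F ha ih =>
    rw [Finset.sum_insert ha, ← ih, ← map_union]
    · congr 1
      ext x; simp
    · rw [Set.disjoint_left]
      rintro x hx hx'
      simp only [Set.mem_preimage, Set.mem_singleton_iff, Finset.mem_coe] at hx hx'
      exact ha (hx ▸ hx')

/-- Since `v` need not be injective, the indices are regrouped by its fibres. This freedom lets two
simple functions be integrated over one common partition. -/
lemma simpleIntegral_eq_sum {ι : Type*} [Fintype ι] (p : X → ι) (v : ι → ℝ) :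
    μ.simpleIntegral (v ∘ p) = ∑ i, v i * μ (p ⁻¹' {i}) := by
  classical
  have key : ∀ y, μ ((v ∘ p) ⁻¹' {y}) = ∑ i with v i = y, μ (p ⁻¹' {i}) := by
    intro y
    rw [← map_preimage_finset]
    congr 1
    ext x; simp
  have h1 : μ.simpleIntegral (v ∘ p) =
      ∑ y ∈ Finset.univ.image v, y * μ ((v ∘ p) ⁻¹' {y}) := by
    apply finsum_eq_sum_of_support_subset
    intro y hy
    by_contra hcon
    apply hy
    have : ∀ i, v i ≠ y := by simpa using hcon
    simp [key, this]
  rw [h1, ← Finset.sum_fiberwise_of_maps_to (g := v) (t := Finset.univ.image v)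
    (fun i _ => Finset.mem_image_of_mem v (Finset.mem_univ i))]
  refine Finset.sum_congr rfl fun y _ => ?_
  rw [key, Finset.mul_sum]
  refine Finset.sum_congr rfl fun i hi => ?_
  rw [(Finset.mem_filter.1 hi).2]

lemma simpleIntegral_const (c : ℝ) : μ.simpleIntegral (fun _ => c) = c := by
  have := μ.simpleIntegral_eq_sum (fun _ : X => ()) (fun _ => c)
  simpa [map_univ, Function.comp_def] using this

/-- Two functions of finite range factor through a common map to a finite type. -/
lemma exists_common_factor {s t : X → ℝ} (hs : (Set.range s).Finite) (ht : (Set.range t).Finite) :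
    ∃ (ι : Type) (_ : Fintype ι) (p : X → ι) (v w : ι → ℝ), s = v ∘ p ∧ t = w ∘ p := by
  have := hs.fintype
  have := ht.fintype
  exact ⟨Set.range s × Set.range t, inferInstance, fun x => (⟨s x, x, rfl⟩, ⟨t x, x, rfl⟩),
    fun i => i.1, fun i => i.2, rfl, rfl⟩

variable {μ} in
lemma simpleIntegral_linear {s t : X → ℝ} (hs : (Set.range s).Finite) (ht : (Set.range t).Finite)
    (a b : ℝ) : μ.simpleIntegral (fun x => a * s x + b * t x) =
      a * μ.simpleIntegral s + b * μ.simpleIntegral t := by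
  obtain ⟨ι, _, p, v, w, rfl, rfl⟩ := exists_common_factor hs ht
  have := μ.simpleIntegral_eq_sum p (fun i => a * v i + b * w i)
  rw [simpleIntegral_eq_sum, simpleIntegral_eq_sum]
  refine this.trans ?_
  rw [Finset.mul_sum, Finset.mul_sum, ← Finset.sum_add_distrib]
  exact Finset.sum_congr rfl fun i _ => by ring

lemma finite_range_linear {s t : X → ℝ} (hs : (Set.range s).Finite) (ht : (Set.range t).Finite)
    (a b : ℝ) : (Set.range (fun x => a * s x + b * t x)).Finite := by
  obtain ⟨ι, _, p, v, w, rfl, rfl⟩ := exists_common_factor hs ht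
  exact (Set.finite_range (fun i => a * v i + b * w i)).subset (by rintro _ ⟨x, rfl⟩; exact ⟨p x, rfl⟩)

lemma finite_range_const (c : ℝ) : (Set.range (fun _ : X => c)).Finite :=
  (Set.finite_singleton c).subset (by rintro _ ⟨x, rfl⟩; rfl)

variable {μ} in
lemma simpleIntegral_mono {s t : X → ℝ} (hs : (Set.range s).Finite) (ht : (Set.range t).Finite)
    (h : ∀ x, s x ≤ t x) : μ.simpleIntegral s ≤ μ.simpleIntegral t := by
  obtain ⟨ι, _, p, v, w, rfl, rfl⟩ := exists_common_factor hs ht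
  rw [simpleIntegral_eq_sum, simpleIntegral_eq_sum]
  refine Finset.sum_le_sum fun i _ => ?_
  by_cases hi : ∃ x, p x = i
  · obtain ⟨x, rfl⟩ := hi
    exact mul_le_mul_of_nonneg_right (h x) (nonneg _ _)
  -- Outside the range of `p` nothing compares `v i` with `w i`, but such indices have mass zero.
  · have : p ⁻¹' {i} = ∅ := by
      ext x; simpa using fun h => hi ⟨x, h⟩
    simp [this, map_empty]

lemma exists_simple_approx {f : X → ℝ} {M : ℝ} (hf : ∀ x, |f x| ≤ M) {ε : ℝ} (hε : 0 < ε) :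
    ∃ s : X → ℝ, (Set.range s).Finite ∧ (∀ x, s x ≤ f x) ∧ ∀ x, f x ≤ s x + ε := by
  refine ⟨fun x => ε * ⌊f x / ε⌋, ?_, fun x => ?_, fun x => ?_⟩
  · refine ((Set.finite_Icc ⌊-M / ε⌋ ⌊M / ε⌋).image (fun n : ℤ => ε * (n : ℝ))).subset ?_
    rintro _ ⟨x, rfl⟩
    refine ⟨⌊f x / ε⌋, ⟨Int.floor_mono ?_, Int.floor_mono ?_⟩, rfl⟩
    · exact div_le_div_of_nonneg_right (neg_le_of_abs_le (hf x)) hε.le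
    · exact div_le_div_of_nonneg_right (le_of_abs_le (hf x)) hε.le
  · have := Int.floor_le (f x / ε)
    rw [le_div_iff₀ hε] at this
    linarith
  · have := (Int.lt_floor_add_one (f x / ε)).le
    rw [div_le_iff₀ hε] at this
    linarith

variable {μ} in
lemma simpleIntegral_le_integralReal {f s : X → ℝ} {M : ℝ} (hf : ∀ x, |f x| ≤ M)
    (hs : (Set.range s).Finite) (h : ∀ x, s x ≤ f x) : μ.simpleIntegral s ≤ μ.integralReal f := by
  refine le_csSup ⟨M, ?_⟩ ⟨s, hs, h, rfl⟩
  rintro _ ⟨t, ht, hle, rfl⟩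
  rw [← μ.simpleIntegral_const M]
  exact simpleIntegral_mono ht (finite_range_const M)
    fun x => (hle x).trans (le_of_abs_le (hf x))

variable {μ} in
lemma integralReal_le_simpleIntegral {f s : X → ℝ} {M : ℝ} (hf : ∀ x, |f x| ≤ M)
    (hs : (Set.range s).Finite) (h : ∀ x, f x ≤ s x) : μ.integralReal f ≤ μ.simpleIntegral s := by
  refine csSup_le ⟨_, fun _ => -M, finite_range_const _, fun x => neg_le_of_abs_le (hf x), rfl⟩ ?_
  rintro _ ⟨t, ht, hle, rfl⟩
  exact simpleIntegral_mono ht hs fun x => (hle x).trans (h x)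

variable {μ} in
-- The simple functions s ± ε sandwich f. Linearity of the integral, not evident from a supremum of
-- lower sums, follows by uniform approximation.
lemma abs_integralReal_sub_simpleIntegral_le {f s : X → ℝ} {M ε : ℝ} (hf : ∀ x, |f x| ≤ M)
    (hs : (Set.range s).Finite) (h : ∀ x, |f x - s x| ≤ ε) :
    |μ.integralReal f - μ.simpleIntegral s| ≤ ε := by
  have e1 := μ.simpleIntegral_const ε
  have h1 := integralReal_le_simpleIntegral (μ := μ) hf
    (finite_range_linear hs (finite_range_const ε) 1 1)
    (fun x => by have := (abs_le.1 (h x)).2; linarith)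
  have h2 := simpleIntegral_le_integralReal (μ := μ) hf
    (finite_range_linear hs (finite_range_const ε) 1 (-1))
    (fun x => by have := (abs_le.1 (h x)).1; linarith)
  rw [simpleIntegral_linear hs (finite_range_const ε), e1] at h1 h2
  rw [abs_le]
  constructor <;> linarith

variable {μ} in
lemma integralReal_linear {f g : X → ℝ} {M N : ℝ} (hf : ∀ x, |f x| ≤ M) (hg : ∀ x, |g x| ≤ N)
    (a b : ℝ) : μ.integralReal (fun x => a * f x + b * g x) =
      a * μ.integralReal f + b * μ.integralReal g := by
  refine eq_of_forall_dist_le fun ε hε => ?_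
  rw [Real.dist_eq]
  -- Two approximations each cost (|a| + |b|)δ; the extra 1 keeps C positive when a = b = 0.
  set C := 2 * (|a| + |b| + 1)
  have hC : 0 < C := by positivity
  have hδ : 0 < ε / C := by positivity
  set δ := ε / C
  obtain ⟨s, hs, hs1, hs2⟩ := exists_simple_approx hf hδ
  obtain ⟨t, ht, ht1, ht2⟩ := exists_simple_approx hg hδ
  have hs' : ∀ x, |f x - s x| ≤ δ := fun x => by
    exact abs_le.2 ⟨by linarith [hs1 x, hs2 x], by linarith [hs1 x, hs2 x]⟩
  have ht' : ∀ x, |g x - t x| ≤ δ := fun x => by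
    rw [abs_le]; constructor <;> linarith [ht1 x, ht2 x]
  have key : ∀ p q r u : ℝ, |p - q| ≤ δ → |r - u| ≤ δ →
      |a * p + b * r - (a * q + b * u)| ≤ |a| * δ + |b| * δ := by
    intro p q r u h1 h2
    calc |a * p + b * r - (a * q + b * u)| = |a * (p - q) + b * (r - u)| := by ring_nf
      _ ≤ |a| * |p - q| + |b| * |r - u| := by
        rw [← abs_mul, ← abs_mul]; exact abs_add_le _ _
      _ ≤ _ := by gcongr
  have hfg : ∀ x, |a * f x + b * g x| ≤ |a| * M + |b| * N := fun x =>
    calc _ ≤ |a| * |f x| + |b| * |g x| := by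
          rw [← abs_mul, ← abs_mul]; exact abs_add_le _ _
      _ ≤ _ := by gcongr <;> simp [hf, hg]
  have h1 := abs_integralReal_sub_simpleIntegral_le (μ := μ) hfg
    (finite_range_linear hs ht a b) (fun x => key _ _ _ _ (hs' x) (ht' x))
  rw [simpleIntegral_linear hs ht] at h1
  have h2 := key _ _ _ _ (abs_integralReal_sub_simpleIntegral_le (μ := μ) hf hs hs')
    (abs_integralReal_sub_simpleIntegral_le (μ := μ) hg ht ht')
  rw [abs_sub_comm] at h2
  have h3 := abs_sub_le (μ.integralReal fun x => a * f x + b * g x)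
    (a * μ.simpleIntegral s + b * μ.simpleIntegral t)
    (a * μ.integralReal f + b * μ.integralReal g)
  have h4 : C * δ = ε := by simp only [δ]; field_simp
  have h5 : C * δ = 2 * (|a| * δ + |b| * δ + δ) := by simp only [C]; ring
  rw [abs_sub_comm (a * μ.simpleIntegral s + _)] at h3
  rw [abs_sub_comm] at h2
  linarith

lemma integralReal_const (c : ℝ) : μ.integralReal (fun _ => c) = c := by
  have := abs_integralReal_sub_simpleIntegral_le (μ := μ) (f := fun _ : X => c) (M := |c|)
    (ε := 0) (fun _ => le_rfl) (finite_range_const c) (by simp)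
  rw [simpleIntegral_const] at this
  exact sub_eq_zero.1 (abs_nonpos_iff.1 this)

variable {μ} in
lemma integralReal_nonneg {f : X → ℝ} {M : ℝ} (hf : ∀ x, |f x| ≤ M) (h : ∀ x, 0 ≤ f x) :
    0 ≤ μ.integralReal f := by
  rw [← μ.simpleIntegral_const 0]
  exact simpleIntegral_le_integralReal hf (finite_range_const 0) h

variable {μ} in
lemma integral_add {f g : X → ℂ} {M N : ℝ} (hf : ∀ x, ‖f x‖ ≤ M) (hg : ∀ x, ‖g x‖ ≤ N) :
    μ.integral (fun x => f x + g x) = μ.integral f + μ.integral g := by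
  have h1 := integralReal_linear (μ := μ) (fun x => (Complex.abs_re_le_norm _).trans (hf x))
    (fun x => (Complex.abs_re_le_norm _).trans (hg x)) 1 1
  have h2 := integralReal_linear (μ := μ) (fun x => (Complex.abs_im_le_norm _).trans (hf x))
    (fun x => (Complex.abs_im_le_norm _).trans (hg x)) 1 1
  simp only [one_mul] at h1 h2
  simp only [integral, Complex.add_re, Complex.add_im, h1, h2]
  push_cast; ring

variable {μ} in
lemma integral_const_mul {f : X → ℂ} {M : ℝ} (hf : ∀ x, ‖f x‖ ≤ M) (c : ℂ) :
    μ.integral (fun x => c * f x) = c * μ.integral f := by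
  have hr := fun x => (Complex.abs_re_le_norm _).trans (hf x)
  have hi := fun x => (Complex.abs_im_le_norm _).trans (hf x)
  have h1 := integralReal_linear (μ := μ) hr hi c.re (-c.im)
  have h2 := integralReal_linear (μ := μ) hr hi c.im c.re
  simp only [neg_mul, ← sub_eq_add_neg] at h1
  have e : ∀ x, (c * f x).im = c.im * (f x).re + c.re * (f x).im := fun x => by
    rw [Complex.mul_im]; ring
  simp only [integral, Complex.mul_re, e, h1, h2]
  apply Complex.ext
  · simp
  · simp; ring

end

/-! ### Ultrafilter limits of finitely supported probability weights. -/

section UltrafilterLimit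

variable {X : Type*} {d : ℕ → ℕ} (e : ∀ n, Fin (d n) → X) (p : ∀ n, Fin (d n) → ℝ)

/-- The limit along a free ultrafilter of the charges `∑ i, p n i * δ_(e n i)`. -/
lemma exists_charge_tendsto_integral (hp : ∀ n i, 0 ≤ p n i) (hp1 : ∀ n, ∑ i, p n i = 1) :
    ∃ μ : ProbabilityCharge (Set X), ∀ (f : X → ℂ) (M : ℝ), (∀ x, ‖f x‖ ≤ M) →
      Tendsto (fun n => ∑ i, (p n i : ℂ) * f (e n i)) (hyperfilter ℕ) (𝓝 (μ.integral f)) := by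
  classical
  let W : ℕ → (X → ℝ) → ℝ := fun n f => ∑ i, p n i * f (e n i)
  have hW : ∀ n f g, (∀ x, f x ≤ g x) → W n f ≤ W n g := fun n f g h =>
    Finset.sum_le_sum fun i _ => mul_le_mul_of_nonneg_left (h _) (hp n i)
  have hWc : ∀ n c, W n (fun _ => c) = c := fun n c => by
    simp only [W, ← Finset.sum_mul, hp1, one_mul]
  have hind : ∀ n (A : Set X), W n (A.indicator 1) ∈ Set.Icc (0 : ℝ) 1 := fun n A => by
    constructor
    · rw [← hWc n 0]
      exact hW _ _ _ fun x => Set.indicator_nonneg (by simp) x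
    · conv_rhs => rw [← hWc n 1]
      exact hW _ _ _ fun x => Set.indicator_le_self' (by simp) x
  have hlim : ∀ A : Set X, ∃ l ∈ Set.Icc (0 : ℝ) 1,
      Tendsto (fun n => W n (A.indicator 1)) (hyperfilter ℕ) (𝓝 l) := fun A => by
    -- Compactness of [0, 1] makes the masses of every set converge along the ultrafilter.
    have := isCompact_Icc.ultrafilter_le_nhds
      ((hyperfilter ℕ).map fun n => W n (A.indicator 1)) (s := Set.Icc (0 : ℝ) 1)
      (le_principal_iff.2 (mem_map.2 (univ_mem' fun n => hind n A)))
    exact this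
  choose l hl hlt using hlim
  have hne : NeBot ((hyperfilter ℕ : Ultrafilter ℕ) : Filter ℕ) := inferInstance
  let μ : ProbabilityCharge (Set X) :=
    { toFun := l
      mem_Icc := hl
      top_eq_one := by
        refine tendsto_nhds_unique (hlt ⊤) ?_
        have : ∀ n, W n ((⊤ : Set X).indicator 1) = 1 := fun n => by
          rw [← hWc n 1]; simp [W]
        simp only [this, tendsto_const_nhds]
      sup_eq_add := fun A C h => by
        refine tendsto_nhds_unique (hlt _) ?_
        refine ((hlt A).add (hlt C)).congr fun n => ?_
        rw [← Finset.sum_add_distrib]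
        refine Finset.sum_congr rfl fun i _ => ?_
        change _ = _ * (A ∪ C).indicator 1 _
        rw [Set.indicator_union_of_disjoint (disjoint_iff.2 h)]
        ring }
  have hsimple : ∀ s : X → ℝ, (Set.range s).Finite →
      Tendsto (fun n => W n s) (hyperfilter ℕ) (𝓝 (μ.simpleIntegral s)) := fun s hs => by
    obtain ⟨ι, _, q, v, w, rfl, -⟩ := exists_common_factor hs hs
    rw [simpleIntegral_eq_sum]
    have : ∀ n, W n (v ∘ q) = ∑ j, v j * W n ((q ⁻¹' {j}).indicator 1) := fun n => by
      simp only [W, Finset.mul_sum]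
      rw [Finset.sum_comm]
      refine Finset.sum_congr rfl fun i _ => ?_
      rw [Finset.sum_eq_single (q (e n i))]
      · simp [mul_comm]
      · intro b _ hb
        simp [Set.indicator, hb.symm]
      · simp
    simp only [this]
    exact tendsto_finsetSum _ fun j _ => (hlt _).const_mul _
  have hreal : ∀ (f : X → ℝ) (M : ℝ), (∀ x, |f x| ≤ M) →
      Tendsto (fun n => W n f) (hyperfilter ℕ) (𝓝 (μ.integralReal f)) := fun f M hf => by
    rw [Metric.tendsto_nhds]
    intro ε hε
    obtain ⟨s, hs, h1, h2⟩ := exists_simple_approx hf (ε := ε / 3) (by positivity)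
    filter_upwards [Metric.tendsto_nhds.1 (hsimple s hs) (ε / 3) (by positivity)] with n hn
    have h3 := abs_integralReal_sub_simpleIntegral_le (μ := μ) hf hs (ε := ε / 3) fun x => by
      rw [abs_le]; constructor <;> linarith [h1 x, h2 x]
    have h4 : W n f ≤ W n s + ε / 3 := by
      have h5 := hW n f (fun x => s x + ε / 3) h2
      have h6 : W n (fun x => s x + ε / 3) = W n s + W n (fun _ => ε / 3) := by
        simp only [W, mul_add, Finset.sum_add_distrib]
      rw [hWc] at h6
      linarith
    have h5 := hW n s f h1
    rw [Real.dist_eq, abs_lt] at hn ⊢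
    rw [abs_le] at h3
    constructor <;> linarith
  refine ⟨μ, fun f M hf => ?_⟩
  have h1 := hreal _ M fun x => (Complex.abs_re_le_norm _).trans (hf x)
  have h2 := hreal _ M fun x => (Complex.abs_im_le_norm _).trans (hf x)
  have h3 := (Complex.continuous_ofReal.tendsto _).comp h1
  have h4 := (Complex.continuous_ofReal.tendsto _).comp h2
  refine (h3.add (h4.mul_const Complex.I)).congr fun n => ?_
  simp only [Function.comp_apply, W, Complex.ofReal_sum, Finset.sum_mul]
  rw [← Finset.sum_add_distrib]
  refine Finset.sum_congr rfl fun i _ => ?_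
  push_cast
  conv_rhs => rw [← Complex.re_add_im (f (e n i))]
  ring

end UltrafilterLimit

end ProbabilityCharge

/-! ### The state induced by a charge. -/

section

variable {H : Type*} [NormedAddCommGroup H] [InnerProductSpace ℂ H] [CompleteSpace H]

/-- The state on `B(H)` induced by a charge on an orthonormal set. -/
noncomputable def inducedState {X : Set H} (hX : Orthonormal ℂ ((↑) : X → H))
    (μ : ProbabilityCharge (Set X)) : (H →L[ℂ] H) →ₚ[ℂ] ℂ :=
  have hb : ∀ (a : H →L[ℂ] H) (x : X), ‖inner ℂ (x : H) (a (x : H))‖ ≤ ‖a‖ := fun a x => by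
    refine (norm_inner_le_norm _ _).trans ?_
    have := a.le_opNorm (x : H)
    rw [hX.1 x] at this ⊢
    simpa using this
  PositiveLinearMap.mk₀
    { toFun := inducedFunctional X μ
      map_add' := fun a b => by
        simp only [inducedFunctional, add_apply, inner_add_right]
        exact ProbabilityCharge.integral_add (hb a) (hb b)
      map_smul' := fun c a => by
        simp only [inducedFunctional, smul_apply, inner_smul_right]
        exact ProbabilityCharge.integral_const_mul (hb a) c }
    fun a ha => by
      have h0 : ∀ x : X, 0 ≤ inner ℂ (x : H) (a (x : H)) := fun x =>
        ((ContinuousLinearMap.nonneg_iff_isPositive a).1 ha).inner_nonneg_right x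
      have h1 : ∀ x : X, (inner ℂ (x : H) (a (x : H))).im = 0 := fun x =>
        (Complex.nonneg_iff.1 (h0 x)).2.symm
      have h2 := ProbabilityCharge.integralReal_nonneg (μ := μ)
        (fun x => (Complex.abs_re_le_norm _).trans (hb a x))
        (fun x => (Complex.nonneg_iff.1 (h0 x)).1)
      change 0 ≤ inducedFunctional X μ a
      simp only [inducedFunctional, ProbabilityCharge.integral, h1,
        ProbabilityCharge.integralReal_const]
      simpa using h2

lemma inducedState_apply {X : Set H} (hX : Orthonormal ℂ ((↑) : X → H))
    (μ : ProbabilityCharge (Set X)) (a : H →L[ℂ] H) :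
    inducedState hX μ a = inducedFunctional X μ a := rfl

lemma inducedState_one {X : Set H} (hX : Orthonormal ℂ ((↑) : X → H))
    (μ : ProbabilityCharge (Set X)) : inducedState hX μ 1 = 1 := by
  have : ∀ x : X, inner ℂ (x : H) ((1 : H →L[ℂ] H) (x : H)) = (1 : ℂ) := fun x => by
    rw [one_apply_eq_self, inner_self_eq_norm_sq_to_K, hX.1 x]; simp
  rw [inducedState_apply, inducedFunctional, funext this, ProbabilityCharge.integral]
  simp [ProbabilityCharge.integralReal_const]

end

/-! ### The conjugation action on B(H). -/

section Conj

variable {H : Type*} [NormedAddCommGroup H] [InnerProductSpace ℂ H] [CompleteSpace H]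
variable {G : Type*} [Group G]

/-- The action `a ↦ π(g) a π(g)*` of `G` on `B(H)`. -/
noncomputable def conjAct (π : G →* unitary (H →L[ℂ] H)) (g : G) :
    (H →L[ℂ] H) →L[ℂ] (H →L[ℂ] H) :=
  (ContinuousLinearMap.mul ℂ (H →L[ℂ] H) (π g : H →L[ℂ] H)).comp
    ((ContinuousLinearMap.mul ℂ (H →L[ℂ] H)).flip (π g⁻¹ : H →L[ℂ] H))

variable (π : G →* unitary (H →L[ℂ] H))

lemma conjAct_apply (g : G) (a : H →L[ℂ] H) :
    conjAct π g a = (π g : H →L[ℂ] H) * a * (π g⁻¹ : H →L[ℂ] H) := by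
  simp [conjAct, mul_assoc]

lemma conjAct_apply_apply (g : G) (a : H →L[ℂ] H) (x : H) :
    conjAct π g a x = (π g : H →L[ℂ] H) (a ((π g⁻¹ : H →L[ℂ] H) x)) := by
  simp [conjAct]

lemma rep_star (g : G) : star (π g : H →L[ℂ] H) = (π g⁻¹ : H →L[ℂ] H) := by
  rw [map_inv]; rfl

lemma rep_mul_apply (g h : G) (x : H) :
    (π (g * h) : H →L[ℂ] H) x = (π g : H →L[ℂ] H) ((π h : H →L[ℂ] H) x) := by
  rw [map_mul]; rfl

lemma rep_real_smul (g : G) (r : ℝ) (x : H) :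
    (π g : H →L[ℂ] H) (r • x) = r • (π g : H →L[ℂ] H) x :=
  (π g : H →L[ℂ] H).map_smul_of_tower r x

lemma rep_inv_apply_self (g : G) (x : H) :
    (π g⁻¹ : H →L[ℂ] H) ((π g : H →L[ℂ] H) x) = x := by
  rw [← rep_mul_apply]; simp

lemma rep_apply_inv_self (g : G) (x : H) :
    (π g : H →L[ℂ] H) ((π g⁻¹ : H →L[ℂ] H) x) = x := by
  rw [← rep_mul_apply]; simp

lemma inner_rep_left (g : G) (x y : H) :
    inner ℂ ((π g : H →L[ℂ] H) x) y = inner ℂ x ((π g⁻¹ : H →L[ℂ] H) y) := by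
  rw [← rep_star, ContinuousLinearMap.star_eq_adjoint, ContinuousLinearMap.adjoint_inner_right]

lemma inner_rep_rep (g : G) (x y : H) :
    inner ℂ ((π g : H →L[ℂ] H) x) ((π g : H →L[ℂ] H) y) = inner ℂ x y := by
  rw [inner_rep_left, rep_inv_apply_self]

lemma norm_rep_apply (g : G) (x : H) : ‖(π g : H →L[ℂ] H) x‖ = ‖x‖ := by
  rw [@norm_eq_sqrt_re_inner ℂ, @norm_eq_sqrt_re_inner ℂ, inner_rep_rep]

lemma conjAct_mul (g h : G) (a : H →L[ℂ] H) :
    conjAct π (g * h) a = conjAct π g (conjAct π h a) := by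
  ext x
  simp only [conjAct_apply_apply, rep_mul_apply, mul_inv_rev]

lemma conjAct_one (g : G) : conjAct π g 1 = 1 := by
  ext x
  simp only [conjAct_apply_apply, one_apply_eq_self, rep_apply_inv_self]

lemma norm_conjAct_apply_apply_le (g : G) (a : H →L[ℂ] H) (x : H) :
    ‖conjAct π g a x‖ ≤ ‖a‖ * ‖x‖ := by
  rw [conjAct_apply_apply, norm_rep_apply]
  exact (a.le_opNorm _).trans_eq (by rw [norm_rep_apply])

lemma norm_conjAct_apply_le (g : G) (a : H →L[ℂ] H) : ‖conjAct π g a‖ ≤ ‖a‖ :=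
  ContinuousLinearMap.opNorm_le_bound _ (norm_nonneg _) (norm_conjAct_apply_apply_le π g a)

lemma isRepInvariant_iff {F : (H →L[ℂ] H) → ℂ} :
    IsRepInvariant π F ↔ ∀ g a, F (conjAct π g a) = F a := by
  constructor
  · intro h g a
    have := h g⁻¹ a
    rwa [rep_star, inv_inv, ← conjAct_apply π g a] at this
  · intro h g a
    have := h g⁻¹ a
    rwa [conjAct_apply, inv_inv, ← rep_star] at this

lemma inner_conjAct (g : G) (a : H →L[ℂ] H) (x : H) :
    inner ℂ x (conjAct π g a x) =
      inner ℂ ((π g⁻¹ : H →L[ℂ] H) x) (a ((π g⁻¹ : H →L[ℂ] H) x)) := by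
  rw [conjAct_apply_apply, inner_rep_left, inv_inv]

variable {π} [TopologicalSpace G]

/-- The operators `π g` are isometric, so strong continuity upgrades to joint continuity in the
group element and the vector. -/
lemma IsStronglyContinuous.continuous_apply (hπ : IsStronglyContinuous π) {Y : Type*}
    [TopologicalSpace Y] {f : Y → G} {y : Y → H} (hf : Continuous f) (hy : Continuous y) :
    Continuous fun t => (π (f t) : H →L[ℂ] H) (y t) := by
  rw [continuous_iff_continuousAt]
  intro t₀
  have h1 : Tendsto (fun t => ‖y t - y t₀‖ +
      ‖(π (f t) : H →L[ℂ] H) (y t₀) - (π (f t₀) : H →L[ℂ] H) (y t₀)‖) (𝓝 t₀) (𝓝 0) := by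
    have c : Continuous fun t => ‖y t - y t₀‖ +
      ‖(π (f t) : H →L[ℂ] H) (y t₀) - (π (f t₀) : H →L[ℂ] H) (y t₀)‖ :=
      (hy.sub continuous_const).norm.add
        ((((hπ (y t₀)).comp hf).sub continuous_const).norm)
    simpa using c.tendsto t₀
  rw [ContinuousAt, tendsto_iff_norm_sub_tendsto_zero]
  refine squeeze_zero (fun _ => norm_nonneg _) (fun t => ?_) h1
  calc _ = ‖(π (f t) : H →L[ℂ] H) (y t - y t₀) +
        ((π (f t) : H →L[ℂ] H) (y t₀) - (π (f t₀) : H →L[ℂ] H) (y t₀))‖ := by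
        rw [map_sub]; congr 1; abel
    _ ≤ _ := (norm_add_le _ _).trans_eq (by rw [norm_rep_apply])

lemma IsStronglyContinuous.continuous_conjAct [IsTopologicalGroup G]
    (hπ : IsStronglyContinuous π) {Y : Type*} [TopologicalSpace Y] {f : Y → G}
    (hf : Continuous f) (a : H →L[ℂ] H) (x : H) :
    Continuous fun t => conjAct π (f t) a x := by
  simp only [conjAct_apply_apply]
  exact hπ.continuous_apply hf
    (a.continuous.comp (hπ.continuous_apply hf.inv continuous_const))

end Conj

/-! ### Continuity of translations in L¹(G). -/

section Translation

open scoped Pointwise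

lemma mem_tsupport_mul_inv {G : Type*} [Group G] [TopologicalSpace G] {u : G → ℝ} {s : Set G} {k g : G} (hk : k ∈ s)
    (h : u (g * k) ≠ 0) : g ∈ tsupport u * s⁻¹ :=
  ⟨g * k, subset_tsupport _ h, k⁻¹, by simpa using hk, by simp⟩

variable {G : Type*} [Group G] [TopologicalSpace G] [IsTopologicalGroup G]
  [LocallyCompactSpace G] [MeasurableSpace G] [BorelSpace G]
  (μ : Measure G) [μ.IsHaarMeasure]

lemma integral_comp_mul_right [μ.InnerRegular]
    {E : Type*} [NormedAddCommGroup E] [NormedSpace ℝ E]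
    (F : G → E) (k : G) :
    ∫ g, F (g * k) ∂μ = (Measure.modularCharacterFun k : ℝ) • ∫ g, F g ∂μ := by
  have h := integral_map_equiv (μ := μ) (MeasurableEquiv.mulRight k) F
  have h2 : Measure.map (MeasurableEquiv.mulRight k) μ = Measure.map (· * k) μ := rfl
  rw [h2, Measure.map_right_mul_eq_modularCharacterFun_smul, integral_smul_nnreal_measure] at h
  exact h.symm

/-- For a bump function f, the modular character is the quotient of ∫ f(gk) dg by ∫ f. The numerator
is continuous in k because the translates have supports in a common compact set locally in k. -/
lemma continuous_modularCharacterFun [μ.InnerRegular] :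
    Continuous (fun k : G => (Measure.modularCharacterFun k : ℝ)) := by
  obtain ⟨⟨f, f_cont⟩, f_comp, f_nonneg, f_one⟩ :
    ∃ f : C(G, ℝ), HasCompactSupport f ∧ 0 ≤ (f : G → ℝ) ∧ f 1 ≠ 0 := exists_continuous_nonneg_pos 1
  have hpos : 0 < ∫ x, f x ∂μ :=
    f_cont.integral_pos_of_hasCompactSupport_nonneg_nonzero f_comp f_nonneg f_one
  have hcont : Continuous fun k => ∫ g, f (g * k) ∂μ := by
    rw [continuous_iff_continuousAt]
    intro k₀
    obtain ⟨s, hs, hsk⟩ := exists_compact_mem_nhds k₀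
    refine (continuousOn_integral_of_compact_support (k := tsupport f * s⁻¹)
      (f_comp.isCompact.mul hs.inv) ?_ fun p x hp hx => ?_).continuousAt hsk
    · exact (f_cont.comp (continuous_snd.mul continuous_fst)).continuousOn
    · by_contra h
      exact hx (mem_tsupport_mul_inv hp h)
  have e : (fun k : G => (Measure.modularCharacterFun k : ℝ)) =
      fun k => (∫ g, f (g * k) ∂μ) /
        ∫ x, f x ∂μ := by
    funext k
    rw [eq_div_iff hpos.ne']
    rw [integral_comp_mul_right, smul_eq_mul]
  rw [e]
  exact hcont.div_const _

variable {u : G → ℝ} (hu : Continuous u) (hc : HasCompactSupport u)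
include hu hc

lemma tendsto_integral_abs_translate_left :
    Tendsto (fun h => ∫ g, |u (h⁻¹ * g) - u g| ∂μ) (𝓝 1) (𝓝 0) := by
  obtain ⟨s, hs, hs1⟩ := exists_compact_mem_nhds (1 : G)
  have : ContinuousAt (fun h => ∫ g, |u (h⁻¹ * g) - u g| ∂μ) 1 := by
    refine (continuousOn_integral_of_compact_support (k := s * tsupport u ∪ tsupport u)
      ((hs.mul hc.isCompact).union hc.isCompact) ?_ fun p x hp hx => ?_).continuousAt hs1
    · exact (((hu.comp (continuous_fst.inv.mul continuous_snd)).sub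
        (hu.comp continuous_snd)).abs).continuousOn
    · have h1 : u x = 0 := image_eq_zero_of_notMem_tsupport fun h => hx (Or.inr h)
      have h2 : u (p⁻¹ * x) = 0 := image_eq_zero_of_notMem_tsupport fun h =>
        hx (Or.inl ⟨p, hp, p⁻¹ * x, h, by simp⟩)
      simp [h1, h2]
  simpa using this.tendsto

/-- The modular factor makes right translation preserve integrals; this is the weight produced by
`repAverage_conjAct`. -/
lemma tendsto_integral_abs_translate_right [μ.InnerRegular] :
    Tendsto (fun k => ∫ g, |(Measure.modularCharacterFun k : ℝ) * u (g * k⁻¹) - u g| ∂μ)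
      (𝓝 1) (𝓝 0) := by
  obtain ⟨s, hs, hs1⟩ := exists_compact_mem_nhds (1 : G)
  have : ContinuousAt
      (fun k => ∫ g, |(Measure.modularCharacterFun k : ℝ) * u (g * k⁻¹) - u g| ∂μ) 1 := by
    refine (continuousOn_integral_of_compact_support (k := tsupport u * s ∪ tsupport u)
      ((hc.isCompact.mul hs).union hc.isCompact) ?_ fun p x hp hx => ?_).continuousAt hs1
    · exact (((((continuous_modularCharacterFun μ).comp continuous_fst).mul
        (hu.comp (continuous_snd.mul continuous_fst.inv))).sub
        (hu.comp continuous_snd)).abs).continuousOn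
    · have h1 : u x = 0 := image_eq_zero_of_notMem_tsupport fun h => hx (Or.inr h)
      have h2 : u (x * p⁻¹) = 0 := image_eq_zero_of_notMem_tsupport fun h =>
        hx (Or.inl ⟨x * p⁻¹, h, p, hp, by simp⟩)
      simp [h1, h2]
  simpa [Measure.modularCharacterFun_map_one] using this.tendsto

end Translation

/-! ### Averaging operators over the group. -/

section Average

variable {H : Type*} [NormedAddCommGroup H] [InnerProductSpace ℂ H] [CompleteSpace H]
variable {G : Type*} [Group G] [TopologicalSpace G] [IsTopologicalGroup G]
  [MeasurableSpace G] [BorelSpace G]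
variable {π : G →* unitary (H →L[ℂ] H)} (hπ : IsStronglyContinuous π)
  (μ : Measure G) [μ.IsHaarMeasure]
  {u : G → ℝ} (hu : Continuous u) (hc : HasCompactSupport u)

include hπ hu hc in
lemma integrable_smul_conjAct (a : H →L[ℂ] H) (x : H) :
    Integrable (fun g => u g • conjAct π g a x) μ :=
  (hu.smul (hπ.continuous_conjAct continuous_id a x)).integrable_of_hasCompactSupport hc.smul_right

/-- The repAverage `a ↦ ∫ u(g) π(g) a π(g)* dμ(g)`, as a strong integral. -/
noncomputable def repAverage : (H →L[ℂ] H) →L[ℂ] (H →L[ℂ] H) :=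
  (LinearMap.mk₂ ℂ (fun (a : H →L[ℂ] H) (x : H) => ∫ g, u g • conjAct π g a x ∂μ)
    (fun a b x => by
      rw [← integral_add (integrable_smul_conjAct hπ μ hu hc a x)
        (integrable_smul_conjAct hπ μ hu hc b x)]
      simp only [map_add, add_apply, smul_add])
    (fun c a x => by
      rw [← integral_smul]
      simp only [map_smul, smul_apply, smul_comm c])
    (fun a x y => by
      rw [← integral_add (integrable_smul_conjAct hπ μ hu hc a x)
        (integrable_smul_conjAct hπ μ hu hc a y)]
      simp only [map_add, smul_add])
    (fun c a x => by
      rw [← integral_smul]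
      simp only [map_smul, smul_comm c])).mkContinuous₂ (∫ g, |u g| ∂μ) fun a x => by
    rw [LinearMap.mk₂_apply]
    refine (norm_integral_le_of_norm_le (g := fun g => |u g| * (‖a‖ * ‖x‖))
      ((hu.abs.integrable_of_hasCompactSupport hc.abs).mul_const _)
      (Eventually.of_forall fun g => ?_)).trans_eq ?_
    · rw [norm_smul, Real.norm_eq_abs]
      exact mul_le_mul_of_nonneg_left (norm_conjAct_apply_apply_le π g a x) (abs_nonneg _)
    · rw [integral_mul_const, mul_assoc]

lemma repAverage_apply (a : H →L[ℂ] H) (x : H) :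
    repAverage hπ μ hu hc a x = ∫ g, u g • conjAct π g a x ∂μ := rfl

lemma inner_repAverage (a : H →L[ℂ] H) (x : H) :
    inner ℂ x (repAverage hπ μ hu hc a x) = ∫ g, u g • inner ℂ x (conjAct π g a x) ∂μ := by
  rw [repAverage_apply, ← integral_inner (integrable_smul_conjAct hπ μ hu hc a x)]
  simp only [inner_smul_right_eq_smul]

/-- L¹ control of the weights gives operator norm control of the averages, which is how norm
continuity arises from a merely strongly continuous π. -/
lemma norm_repAverage_sub_repAverage_le {w : G → ℝ} (hw : Continuous w) (hcw : HasCompactSupport w)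
    (a : H →L[ℂ] H) : ‖repAverage hπ μ hw hcw a - repAverage hπ μ hu hc a‖ ≤
      (∫ g, |w g - u g| ∂μ) * ‖a‖ := by
  refine ContinuousLinearMap.opNorm_le_bound _
    (mul_nonneg (integral_nonneg fun _ => abs_nonneg _) (norm_nonneg _)) fun x => ?_
  rw [sub_apply, repAverage_apply, repAverage_apply,
    ← integral_sub (integrable_smul_conjAct hπ μ hw hcw a x) (integrable_smul_conjAct hπ μ hu hc a x)]
  refine (norm_integral_le_of_norm_le (g := fun g => |w g - u g| * (‖a‖ * ‖x‖))
      (((hw.sub hu).abs.integrable_of_hasCompactSupport (hcw.sub hc).abs).mul_const _)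
      (Eventually.of_forall fun g => ?_)).trans_eq ?_
  · rw [← sub_smul, norm_smul, Real.norm_eq_abs]
    exact mul_le_mul_of_nonneg_left (norm_conjAct_apply_apply_le π g a x) (abs_nonneg _)
  · rw [integral_mul_const, mul_assoc]

lemma repAverage_one (h1 : ∫ g, u g ∂μ = 1) : repAverage hπ μ hu hc 1 = 1 := by
  ext x
  rw [repAverage_apply]
  simp only [conjAct_one, integral_smul_const, h1, one_smul]

lemma repAverage_nonneg (h0 : 0 ≤ u) {a : H →L[ℂ] H} (ha : 0 ≤ a) :
    0 ≤ repAverage hπ μ hu hc a := by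
  have hpos : ∀ x, 0 ≤ inner ℂ x (repAverage hπ μ hu hc a x) := fun x => by
    rw [inner_repAverage]
    refine integral_nonneg fun g => smul_nonneg (h0 g) ?_
    rw [inner_conjAct]
    exact ((ContinuousLinearMap.nonneg_iff_isPositive a).1 ha).inner_nonneg_right _
  rw [ContinuousLinearMap.nonneg_iff_isPositive, ContinuousLinearMap.isPositive_iff_complex]
  intro x
  have h := hpos x
  rw [Complex.nonneg_iff] at h
  rw [← inner_conj_symm (𝕜 := ℂ) _ x]
  constructor
  · apply Complex.ext
    · simp
    · rw [Complex.conj_im, ← h.2]; simp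
  · simpa only [Complex.conj_re, RCLike.re_eq_complex_re] using h.1

omit [MeasurableSpace G] [BorelSpace G] in
include hc in
lemma hasCompactSupport_comp_mul_left (h : G) : HasCompactSupport fun g => u (h * g) :=
  hc.comp_homeomorph (Homeomorph.mulLeft h)

omit [MeasurableSpace G] [BorelSpace G] in
include hc in
lemma hasCompactSupport_comp_mul_right (h : G) : HasCompactSupport fun g => u (g * h) :=
  hc.comp_homeomorph (Homeomorph.mulRight h)

lemma conjAct_repAverage (h : G) (a : H →L[ℂ] H) :
    conjAct π h (repAverage hπ μ hu hc a) =
      repAverage hπ μ (u := fun g => u (h⁻¹ * g)) (hu.comp (continuous_const_mul h⁻¹))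
        (hasCompactSupport_comp_mul_left hc h⁻¹) a := by
  ext x
  rw [conjAct_apply_apply, repAverage_apply, repAverage_apply,
    ← ContinuousLinearMap.integral_comp_comm _ (integrable_smul_conjAct hπ μ hu hc a _),
    ← integral_mul_left_eq_self (fun g => u (h⁻¹ * g) • conjAct π g a x) h]
  refine integral_congr_ae (Eventually.of_forall fun g => ?_)
  simp only [inv_mul_cancel_left, conjAct_mul, rep_real_smul, conjAct_apply_apply]

lemma repAverage_conjAct [LocallyCompactSpace G] [μ.InnerRegular] (k : G)
    (a : H →L[ℂ] H) :
    repAverage hπ μ hu hc (conjAct π k a) =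
      repAverage hπ μ (u := fun g => (Measure.modularCharacterFun k : ℝ) * u (g * k⁻¹))
        (continuous_const.mul (hu.comp (continuous_mul_const k⁻¹)))
        (hasCompactSupport_comp_mul_right hc k⁻¹).mul_left a := by
  ext x
  rw [repAverage_apply, repAverage_apply]
  simp only [mul_smul, integral_smul]
  rw [← integral_comp_mul_right]
  simp only [conjAct_mul, mul_inv_cancel_right]

/-- The neighbourhood of 1 is chosen before `a`: only the L¹ distance of two weights matters. This
uniformity later permits a finite cover of a compact set. -/
lemma tendsto_repAverage_conjAct [LocallyCompactSpace G] [μ.InnerRegular]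
    {ε : ℝ} (hε : 0 < ε) :
    ∀ᶠ k in 𝓝 (1 : G), ∀ a : H →L[ℂ] H,
      ‖repAverage hπ μ hu hc (conjAct π k a) - repAverage hπ μ hu hc a‖ ≤ ε * ‖a‖ := by
  filter_upwards [(tendsto_integral_abs_translate_right μ hu hc).eventually_le_const hε]
    with k hk a
  rw [repAverage_conjAct]
  exact (norm_repAverage_sub_repAverage_le hπ μ hu hc _ _ a).trans
    (mul_le_mul_of_nonneg_right hk (norm_nonneg _))

lemma continuous_conjAct_repAverage [LocallyCompactSpace G] (a : H →L[ℂ] H) :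
    Continuous fun h => conjAct π h (repAverage hπ μ hu hc a) := by
  have h1 : Tendsto (fun h => conjAct π h (repAverage hπ μ hu hc a)) (𝓝 1)
      (𝓝 (repAverage hπ μ hu hc a)) := by
    rw [tendsto_iff_norm_sub_tendsto_zero]
    have h2 := (tendsto_integral_abs_translate_left μ hu hc).mul_const ‖a‖
    rw [zero_mul] at h2
    refine squeeze_zero (fun _ => norm_nonneg _) (fun h => ?_) h2
    rw [conjAct_repAverage]
    exact norm_repAverage_sub_repAverage_le hπ μ hu hc _ _ a
  rw [continuous_iff_continuousAt]
  intro h₀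
  -- Continuity at 1 is transported to `h₀` by the bounded map `conjAct π h₀`.
  have h3 : Tendsto (fun h => conjAct π h₀ (conjAct π (h₀⁻¹ * h) (repAverage hπ μ hu hc a)))
      (𝓝 h₀) (𝓝 (conjAct π h₀ (repAverage hπ μ hu hc a))) := by
    refine ((conjAct π h₀).continuous.tendsto _).comp (h1.comp ?_)
    have := (continuous_const_mul h₀⁻¹).tendsto h₀
    rwa [inv_mul_cancel] at this
  refine h3.congr fun h => ?_
  rw [← conjAct_mul, mul_inv_cancel_left]

lemma continuous_repAverage_conjAct [LocallyCompactSpace G] [μ.InnerRegular] (a : H →L[ℂ] H) :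
    Continuous fun k => repAverage hπ μ hu hc (conjAct π k a) := by
  rw [continuous_iff_continuousAt]
  intro k₀
  have h1 : Tendsto (fun k => repAverage hπ μ hu hc (conjAct π k (conjAct π k₀ a))) (𝓝 1)
      (𝓝 (repAverage hπ μ hu hc (conjAct π k₀ a))) := by
    rw [tendsto_iff_norm_sub_tendsto_zero]
    have h2 := (tendsto_integral_abs_translate_right μ hu hc).mul_const ‖conjAct π k₀ a‖
    rw [zero_mul] at h2
    refine squeeze_zero (fun _ => norm_nonneg _) (fun h => ?_) h2
    rw [repAverage_conjAct]
    exact norm_repAverage_sub_repAverage_le hπ μ hu hc _ _ _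
  have h3 := (continuous_mul_const k₀⁻¹).tendsto k₀
  rw [mul_inv_cancel] at h3
  refine (h1.comp h3).congr fun k => ?_
  rw [Function.comp_apply, ← conjAct_mul, inv_mul_cancel_right]

/-- Fubini for the compactly supported integrand on G × G: the inner average is pulled outside. -/
lemma repAverage_repAverage_apply {v : G → ℝ} (hv : Continuous v)
    (hcv : HasCompactSupport v) (a : H →L[ℂ] H) (x : H) :
    repAverage hπ μ hu hc (repAverage hπ μ hv hcv a) x =
      ∫ g, v g • repAverage hπ μ hu hc (conjAct π g a) x ∂μ := by
  have e1 : ∀ h, u h • conjAct π h (repAverage hπ μ hv hcv a) x =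
      ∫ g, (u h * v g) • conjAct π (h * g) a x ∂μ := fun h => by
    rw [conjAct_apply_apply, repAverage_apply,
      ← ContinuousLinearMap.integral_comp_comm _ (integrable_smul_conjAct hπ μ hv hcv a _),
      ← integral_smul]
    simp only [conjAct_mul, mul_smul, rep_real_smul, conjAct_apply_apply π h]
  rw [repAverage_apply]
  simp only [e1]
  rw [integral_integral_swap_of_hasCompactSupport]
  · refine integral_congr_ae (Eventually.of_forall fun g => ?_)
    simp only [repAverage_apply]
    rw [← integral_smul]
    refine integral_congr_ae (Eventually.of_forall fun h => ?_)
    simp only [conjAct_mul, smul_smul, mul_comm]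
  · exact ((hu.comp continuous_fst).mul (hv.comp continuous_snd)).smul
      (hπ.continuous_conjAct (continuous_fst.mul continuous_snd) a x)
  · refine HasCompactSupport.of_support_subset_isCompact (hc.isCompact.prod hcv.isCompact) ?_
    rintro ⟨h, g⟩ hne
    simp only [Function.mem_support, Function.uncurry] at hne
    constructor
    · by_contra hcon
      exact hne (by rw [image_eq_zero_of_notMem_tsupport hcon]; simp)
    · by_contra hcon
      exact hne (by rw [image_eq_zero_of_notMem_tsupport hcon]; simp)

lemma norm_repAverage_repAverage_sub_le [LocallyCompactSpace G] [μ.InnerRegular] {v : G → ℝ} (hv : Continuous v)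
    (hcv : HasCompactSupport v) (hv0 : 0 ≤ v) (hv1 : ∫ g, v g ∂μ = 1) {a : H →L[ℂ] H} {ε : ℝ}
    (h : ∀ g, v g ≠ 0 → ‖repAverage hπ μ hu hc (conjAct π g a) - repAverage hπ μ hu hc a‖ ≤ ε) :
    ‖repAverage hπ μ hu hc (repAverage hπ μ hv hcv a) - repAverage hπ μ hu hc a‖ ≤ ε := by
  have hε : 0 ≤ ε := by
    have : ∃ g, v g ≠ 0 := by
      by_contra! hcon
      simp [hcon] at hv1
    obtain ⟨g, hg⟩ := this
    exact (norm_nonneg _).trans (h g hg)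
  refine ContinuousLinearMap.opNorm_le_bound _ hε fun x => ?_
  have hvi := hv.integrable_of_hasCompactSupport (μ := μ) hcv
  have hint : Integrable (fun g => v g • repAverage hπ μ hu hc (conjAct π g a) x) μ :=
    (hv.smul ((continuous_repAverage_conjAct hπ μ hu hc a).clm_apply
      continuous_const)).integrable_of_hasCompactSupport hcv.smul_right
  have e : repAverage hπ μ hu hc a x = ∫ g, v g • repAverage hπ μ hu hc a x ∂μ := by
    rw [integral_smul_const, hv1, one_smul]
  rw [sub_apply, repAverage_repAverage_apply, e, ← integral_sub hint (hvi.smul_const _)]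
  refine (norm_integral_le_of_norm_le (g := fun g => v g * (ε * ‖x‖))
    (hvi.mul_const _) (Eventually.of_forall fun g => ?_)).trans_eq ?_
  · rw [← smul_sub, norm_smul, Real.norm_of_nonneg (hv0 g)]
    by_cases hg : v g = 0
    · simp [hg]
    · refine mul_le_mul_of_nonneg_left ?_ (hv0 g)
      rw [← sub_apply]
      exact (ContinuousLinearMap.le_opNorm _ _).trans
        (mul_le_mul_of_nonneg_right (h g hg) (norm_nonneg _))
  · rw [integral_mul_const, hv1, one_mul]

end Average

/-! ### From invariance to topological invariance. -/

section TopologicalInvariance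

variable {G : Type*} [Group G] [TopologicalSpace G] [IsTopologicalGroup G]
  [LocallyCompactSpace G] [MeasurableSpace G] [BorelSpace G]
  (μ : Measure G) [μ.IsHaarMeasure]

lemma exists_density_support_subset {U : Set G} (hU : U ∈ 𝓝 (1 : G)) :
    ∃ v : G → ℝ, Continuous v ∧ HasCompactSupport v ∧ 0 ≤ v ∧ ∫ g, v g ∂μ = 1 ∧
      ∀ g, v g ≠ 0 → g ∈ U := by
  obtain ⟨f, hf1, hf0, hfc, hf⟩ := exists_continuous_one_zero_of_isCompact
    (isCompact_singleton (x := (1 : G))) (isOpen_interior (s := U)).isClosed_compl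
    (by rw [Set.disjoint_singleton_left]; simpa using mem_interior_iff_mem_nhds.2 hU)
  have hpos : 0 < ∫ g, f g ∂μ :=
    f.continuous.integral_pos_of_hasCompactSupport_nonneg_nonzero hfc (fun g => (hf g).1)
      (x := 1) (by rw [hf1 rfl]; simp)
  refine ⟨fun g => (∫ g, f g ∂μ)⁻¹ * f g, continuous_const.mul f.continuous, hfc.mul_left,
    fun g => mul_nonneg (inv_nonneg.2 hpos.le) (hf g).1, ?_, fun g hg => ?_⟩
  · rw [integral_const_mul, inv_mul_cancel₀ hpos.ne']
  · by_contra hcon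
    apply hg
    have : f g = 0 := hf0 (fun h => hcon (interior_subset h))
    simp [this]

variable {H : Type*} [NormedAddCommGroup H] [InnerProductSpace ℂ H] [CompleteSpace H]
variable {π : G →* unitary (H →L[ℂ] H)} (hπ : IsStronglyContinuous π)
  {u : G → ℝ} (hu : Continuous u) (hc : HasCompactSupport u) (hu1 : ∫ g, u g ∂μ = 1)
  {φ : (H →L[ℂ] H) →L[ℂ] ℂ} (hφ : ∀ g a, φ (conjAct π g a) = φ a)

omit [LocallyCompactSpace G] in
include hφ hu1 in
-- A norm continuous orbit turns the strong integral into a Bochner integral in B(H), through which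
-- φ passes. For general `b` this fails to be available, since φ need not be normal.
lemma apply_repAverage_of_continuous {b : H →L[ℂ] H} (hb : Continuous fun h => conjAct π h b) :
    φ (repAverage hπ μ hu hc b) = φ b := by
  have hint : Integrable (fun h => u h • conjAct π h b) μ :=
    (hu.smul hb).integrable_of_hasCompactSupport hc.smul_right
  have e : repAverage hπ μ hu hc b = ∫ h, u h • conjAct π h b ∂μ := by
    ext x
    rw [ContinuousLinearMap.integral_apply hint, repAverage_apply]
    rfl
  rw [e, ← ContinuousLinearMap.integral_comp_comm _ hint]
  have : ∀ h, φ (u h • conjAct π h b) = u h • φ b := fun h => by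
    rw [← hφ h b]
    exact φ.map_smul_of_tower (u h) _
  simp only [this, integral_smul_const, hu1, one_smul]

variable [μ.InnerRegular]

include hφ hu1 in
-- Take a density v concentrated near 1. Then A_u a and A_w a are close in norm to A_u A_v a and A_w
-- A_v a, and φ sends both of these to φ(A_v a) because A_v a has a norm continuous orbit.
lemma apply_repAverage_eq {w : G → ℝ} (hw : Continuous w) (hcw : HasCompactSupport w)
    (hw1 : ∫ g, w g ∂μ = 1) (a : H →L[ℂ] H) :
    φ (repAverage hπ μ hu hc a) = φ (repAverage hπ μ hw hcw a) := by
  refine eq_of_forall_dist_le fun ε hε => ?_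
  -- Each of the two approximations then costs at most ε / 2 after applying φ.
  set C := 2 * (‖φ‖ + 1) * (‖a‖ + 1)
  have hC : 0 < C := by positivity
  obtain ⟨v, hv, hcv, hv0, hv1, hvs⟩ := exists_density_support_subset μ
    ((tendsto_repAverage_conjAct hπ μ hu hc (ε := ε / C) (by positivity)).and
      (tendsto_repAverage_conjAct hπ μ hw hcw (ε := ε / C) (by positivity)))
  have h1 := norm_repAverage_repAverage_sub_le hπ μ hu hc hv hcv hv0 hv1
    (fun g hg => (hvs g hg).1 a)
  have h2 := norm_repAverage_repAverage_sub_le hπ μ hw hcw hv hcv hv0 hv1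
    (fun g hg => (hvs g hg).2 a)
  have hb := continuous_conjAct_repAverage hπ μ hv hcv a
  have e1 := apply_repAverage_of_continuous μ hπ hu hc hu1 hφ hb
  have e2 := apply_repAverage_of_continuous μ hπ hw hcw hw1 hφ hb
  have h3 := (φ.le_opNorm _).trans (mul_le_mul_of_nonneg_left h1 (norm_nonneg φ))
  have h4 := (φ.le_opNorm _).trans (mul_le_mul_of_nonneg_left h2 (norm_nonneg φ))
  rw [map_sub, e1] at h3
  rw [map_sub, e2] at h4
  have h5 : ‖φ‖ * (ε / C * ‖a‖) ≤ ε / 2 := by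
    have : ‖φ‖ * (ε / C * ‖a‖) = ε / C * (‖φ‖ * ‖a‖) := by ring
    rw [this, div_mul_eq_mul_div, div_le_iff₀ hC]
    have : ‖φ‖ * ‖a‖ ≤ (‖φ‖ + 1) * (‖a‖ + 1) := by
      gcongr <;> linarith
    calc ε * (‖φ‖ * ‖a‖) ≤ ε * ((‖φ‖ + 1) * (‖a‖ + 1)) := by gcongr
      _ = ε / 2 * C := by simp only [C]; ring
  rw [← dist_eq_norm, dist_comm] at h3
  rw [← dist_eq_norm] at h4
  linarith [dist_triangle (φ (repAverage hπ μ hu hc a)) (φ (repAverage hπ μ hv hcv a))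
    (φ (repAverage hπ μ hw hcw a))]

include hφ hu1 in
-- Conjugating inside the average only replaces u by another weight of integral 1, and φ does not
-- see which one is used.
lemma apply_repAverage_conjAct (k : G) (a : H →L[ℂ] H) :
    φ (repAverage hπ μ hu hc (conjAct π k a)) = φ (repAverage hπ μ hu hc a) := by
  rw [repAverage_conjAct]
  refine apply_repAverage_eq μ hπ _ _ ?_ hφ hu hc hu1 a
  have h := integral_comp_mul_right μ
    (fun g => (Measure.modularCharacterFun k : ℝ) * u (g * k⁻¹)) k
  simp only [mul_inv_cancel_right, integral_const_mul, hu1, smul_eq_mul] at h ⊢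
  exact (mul_left_cancel₀ (NNReal.coe_ne_zero.2 (Measure.modularCharacterFun_pos k).ne') h).symm

end TopologicalInvariance

/-! ### The predual of B(H) and Hahn–Banach separation. -/

section NormalFunctionals

variable {H : Type*} [NormedAddCommGroup H] [InnerProductSpace ℂ H]

/-- The functional `a ↦ ⟪x, a y⟫` on `B(H)`. -/
noncomputable def vecFunctional (x y : H) : (H →L[ℂ] H) →L[ℂ] ℂ :=
  (innerSL ℂ x).comp (ContinuousLinearMap.apply ℂ H y)

lemma vecFunctional_apply (x y : H) (a : H →L[ℂ] H) :
    vecFunctional x y a = inner ℂ x (a y) := rfl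

lemma continuous_vecFunctional_self : Continuous fun x : H => vecFunctional x x :=
  (innerSL ℂ).continuous.clm_comp (ContinuousLinearMap.apply ℂ H).continuous

lemma norm_vecFunctional_le (x y : H) : ‖vecFunctional x y‖ ≤ ‖x‖ * ‖y‖ := by
  refine ContinuousLinearMap.opNorm_le_bound _ (by positivity) fun a => ?_
  rw [vecFunctional_apply]
  refine (norm_inner_le_norm _ _).trans ?_
  have := a.le_opNorm y
  calc ‖x‖ * ‖a y‖ ≤ ‖x‖ * (‖a‖ * ‖y‖) := by gcongr
    _ = _ := by ring

variable (H) in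
/-- The closed span of the vector functionals, that is, the predual of `B(H)`. -/
noncomputable def normalFunctionals : Submodule ℂ ((H →L[ℂ] H) →L[ℂ] ℂ) :=
  (Submodule.span ℂ (Set.range fun x : H => vecFunctional x x)).topologicalClosure

variable (H) in
/-- The convex hull of the vector states. -/
def finiteRankStates : Set ((H →L[ℂ] H) →L[ℂ] ℂ) :=
  convexHull ℝ ((fun x : H => vecFunctional x x) '' Metric.sphere 0 1)

lemma vecFunctional_mem_normalFunctionals (x : H) : vecFunctional x x ∈ normalFunctionals H :=
  Submodule.le_topologicalClosure _ (Submodule.subset_span ⟨x, rfl⟩)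

lemma closure_finiteRankStates_subset :
    closure (finiteRankStates H) ⊆ normalFunctionals H := by
  refine closure_minimal (convexHull_min ?_ ?_) (Submodule.isClosed_topologicalClosure _)
  · rintro _ ⟨x, -, rfl⟩
    exact vecFunctional_mem_normalFunctionals x
  · exact ((normalFunctionals H).restrictScalars ℝ).convex

variable [CompleteSpace H]

/-- The dual of the predual of `B(H)` is `B(H)`. -/
lemma exists_eq_apply_of_mem_normalFunctionals (f : ((H →L[ℂ] H) →L[ℂ] ℂ) →L[ℂ] ℂ) :
    ∃ b : H →L[ℂ] H, ∀ θ ∈ normalFunctionals H, f θ = θ b := by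
  let B : H →L⋆[ℂ] H →L[ℂ] ℂ :=
    (LinearMap.mk₂'ₛₗ (starRingEnd ℂ) (RingHom.id ℂ) (fun x y => f (vecFunctional x y))
      (fun x x' y => by
        rw [← map_add]; congr 1; ext a; simp [vecFunctional_apply])
      (fun c x y => by
        rw [← map_smul]; congr 1; ext a; simp [vecFunctional_apply, mul_comm])
      (fun x y y' => by
        rw [← map_add]; congr 1; ext a; simp [vecFunctional_apply])
      (fun c x y => by
        rw [RingHom.id_apply, ← map_smul]; congr 1; ext a
        simp [vecFunctional_apply])).mkContinuous₂ ‖f‖ fun x y => by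
      rw [mul_assoc]
      exact f.le_opNorm_of_le (norm_vecFunctional_le x y)
  -- The operator representing `B` acts in the first slot of the inner product; the adjoint moves it
  -- to the second.
  refine ⟨ContinuousLinearMap.adjoint (InnerProductSpace.continuousLinearMapOfBilin B), ?_⟩
  set b := ContinuousLinearMap.adjoint (InnerProductSpace.continuousLinearMapOfBilin B) with hb
  have key : Set.EqOn f (ContinuousLinearMap.apply ℂ ℂ b)
      (Submodule.span ℂ (Set.range fun x : H => vecFunctional x x)) := by
    refine LinearMap.eqOn_span' (f := f.toLinearMap)
      (g := (ContinuousLinearMap.apply ℂ ℂ b).toLinearMap) ?_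
    rintro _ ⟨x, rfl⟩
    change f (vecFunctional x x) = inner ℂ x (b x)
    rw [hb, ContinuousLinearMap.adjoint_inner_right,
      InnerProductSpace.continuousLinearMapOfBilin_apply]
    rfl
  exact fun θ hθ => key.closure f.continuous (ContinuousLinearMap.apply ℂ ℂ b).continuous hθ

/-- Both 1 and ‖a‖ − a are positive, so φ takes real values on them. -/
lemma im_apply_eq_zero {φ : (H →L[ℂ] H) →L[ℂ] ℂ} (hφ0 : ∀ a, 0 ≤ a → 0 ≤ φ a)
    {a : H →L[ℂ] H} (ha : IsSelfAdjoint a) : (φ a).im = 0 := by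
  have h1 := hφ0 _ (sub_nonneg.2 ha.le_algebraMap_norm_self)
  have h2 := hφ0 1 zero_le_one
  rw [map_sub, Algebra.algebraMap_eq_smul_one, φ.map_smul_of_tower, Complex.nonneg_iff] at h1
  rw [Complex.nonneg_iff] at h2
  have h3 := h1.2
  rw [Complex.sub_im, Complex.smul_im, ← h2.2] at h3
  simpa using h3.symm

/-- A state vanishes on no operator whose numerical range has real part bounded below. -/
lemma apply_ne_zero_of_re_inner_ge {φ : (H →L[ℂ] H) →L[ℂ] ℂ} (hφ0 : ∀ a, 0 ≤ a → 0 ≤ φ a)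
    (hφ1 : φ 1 = 1) {c : H →L[ℂ] H} {δ : ℝ} (hδ : 0 < δ)
    (hc : ∀ x : H, ‖x‖ = 1 → δ ≤ (inner ℂ x (c x)).re) : φ c ≠ 0 := by
  intro h0
  have hc' : ∀ x : H, δ * ‖x‖ ^ 2 ≤ (inner ℂ x (c x)).re := fun x => by
    by_cases hx : x = 0
    · simp [hx]
    · have hx' : 0 < ‖x‖ := norm_pos_iff.2 hx
      have h := hc ((‖x‖⁻¹ : ℂ) • x) (by simp [norm_smul, hx'.ne'])
      have e : (inner ℂ ((‖x‖⁻¹ : ℂ) • x) (c ((‖x‖⁻¹ : ℂ) • x)) : ℂ) =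
          ((‖x‖⁻¹ ^ 2 : ℝ) : ℂ) * inner ℂ x (c x) := by
        rw [map_smul, inner_smul_left, inner_smul_right]
        simp; ring
      rw [e, Complex.re_ofReal_mul, inv_pow, inv_mul_eq_div, le_div_iff₀ (by positivity)] at h
      exact h
  -- Used twice: for vector functionals it gives Re c ≥ δ, and for φ it then gives Re φ(c) ≥ δ.
  have hre : ∀ ψ : (H →L[ℂ] H) →L[ℂ] ℂ, (∀ a, 0 ≤ a → 0 ≤ ψ a) →
      (ψ c).re = (ψ (realPart c : H →L[ℂ] H)).re := fun ψ hψ => by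
    conv_lhs => rw [← realPart_add_I_smul_imaginaryPart c]
    rw [map_add, map_smul, Complex.add_re, smul_eq_mul, Complex.I_mul_re,
      im_apply_eq_zero hψ (imaginaryPart c).2, neg_zero, add_zero]
  have hpos : 0 ≤ (realPart c : H →L[ℂ] H) - ((δ : ℝ) : ℂ) • (1 : H →L[ℂ] H) := by
    rw [ContinuousLinearMap.nonneg_iff_isPositive, ContinuousLinearMap.isPositive_def']
    refine ⟨(realPart c).2.sub ?_, fun x => ?_⟩
    · rw [IsSelfAdjoint, star_smul, star_one]; simp
    · have h1 := hre (vecFunctional x x) fun a ha =>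
        ((ContinuousLinearMap.nonneg_iff_isPositive a).1 ha).inner_nonneg_right x
      rw [vecFunctional_apply, vecFunctional_apply] at h1
      have h2 : (inner ℂ x ((((δ : ℝ) : ℂ) • (1 : H →L[ℂ] H)) x)).re = δ * ‖x‖ ^ 2 := by
        rw [smul_apply, one_apply_eq_self, inner_smul_right, Complex.re_ofReal_mul,
          inner_self_eq_norm_sq_to_K]
        norm_cast
      rw [ContinuousLinearMap.reApplyInnerSelf_apply, inner_re_symm, sub_apply, inner_sub_right,
        map_sub, RCLike.re_eq_complex_re, h2, ← h1]
      linarith [hc' x]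
  have h3 := hφ0 _ hpos
  rw [map_sub, map_smul, hφ1, Complex.nonneg_iff] at h3
  have h4 := h3.1
  rw [Complex.sub_re, ← hre φ hφ0, h0] at h4
  simp at h4
  linarith

lemma exists_re_ge_of_zero_notMem_closure {E : Type*} [NormedAddCommGroup E] [NormedSpace ℂ E]
    {C : Set E} (hC : Convex ℝ C) (h0 : (0 : E) ∉ closure C) :
    ∃ (f : E →L[ℂ] ℂ) (δ : ℝ), 0 < δ ∧ ∀ x ∈ C, δ ≤ (f x).re := by
  obtain ⟨f, δ, hδ, hf⟩ := RCLike.geometric_hahn_banach_point_closed (𝕜 := ℂ)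
    hC.closure isClosed_closure h0
  rw [map_zero] at hδ
  exact ⟨f, δ, by simpa using hδ, fun x hx => (hf x (subset_closure hx)).le⟩

/-- If a state annihilates the ranges of finitely many maps which transport vector states to
normal functionals, then convex combinations of vector states almost annihilate them in norm. -/
lemma exists_finiteRankState_norm_comp_lt {φ : (H →L[ℂ] H) →L[ℂ] ℂ}
    (hφ0 : ∀ a, 0 ≤ a → 0 ≤ φ a) (hφ1 : φ 1 = 1) {ι : Type*} [Fintype ι]
    (M : ι → (H →L[ℂ] H) →L[ℂ] (H →L[ℂ] H))
    (hM : ∀ i x, ‖x‖ = 1 → (vecFunctional x x).comp (M i) ∈ normalFunctionals H)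
    (hφM : ∀ i b, φ (M i b) = 0) {ε : ℝ} (hε : 0 < ε) :
    ∃ ω ∈ finiteRankStates H, ∀ i, ‖ω.comp (M i)‖ < ε := by
  classical
  -- All maps are handled at once in a finite product. If 0 is not in the closure of the image, a
  -- separating functional has components given by operators b i, and c = ∑ M i (b i) has numerical
  -- range of real part at least δ although φ c = 0.
  let R : ((H →L[ℂ] H) →L[ℂ] ℂ) →L[ℂ] (ι → (H →L[ℂ] H) →L[ℂ] ℂ) :=
    ContinuousLinearMap.pi fun i => ContinuousLinearMap.precomp ℂ (M i)
  have hR : ∀ ω i, R ω i = ω.comp (M i) := fun ω i => rfl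
  by_cases h0 : (0 : ι → (H →L[ℂ] H) →L[ℂ] ℂ) ∈ closure (R '' finiteRankStates H)
  · obtain ⟨_, ⟨ω, hω, rfl⟩, hlt⟩ := Metric.mem_closure_iff.1 h0 ε hε
    refine ⟨ω, hω, fun i => ?_⟩
    rw [dist_comm, dist_zero_right] at hlt
    exact (norm_le_pi_norm (R ω) i).trans_lt hlt
  · exfalso
    have hconv : Convex ℝ (R '' finiteRankStates H) :=
      (convex_convexHull ℝ _).is_linear_image
        ⟨fun x y => R.map_add x y, fun c x => R.map_smul_of_tower c x⟩
    obtain ⟨f, δ, hδ, hf⟩ := exists_re_ge_of_zero_notMem_closure hconv h0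
    have hb := fun i => exists_eq_apply_of_mem_normalFunctionals
      (f.comp (ContinuousLinearMap.single ℂ (fun _ : ι => (H →L[ℂ] H) →L[ℂ] ℂ) i))
    choose b hb using hb
    refine apply_ne_zero_of_re_inner_ge hφ0 hφ1 (c := ∑ i, M i (b i)) hδ
      (fun x hx => ?_) (by rw [map_sum]; exact Finset.sum_eq_zero fun i _ => hφM i _)
    have h1 := hf _ ⟨_, subset_convexHull ℝ _ ⟨x, by simpa using hx, rfl⟩, rfl⟩
    have h2 : f (R (vecFunctional x x)) = inner ℂ x ((∑ i, M i (b i)) x) := by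
      have e : R (vecFunctional x x) =
          ∑ i, Pi.single i ((vecFunctional x x).comp (M i)) := by
        rw [Finset.univ_sum_single]; rfl
      rw [e, map_sum, sum_apply, inner_sum]
      exact Finset.sum_congr rfl fun i _ => hb i _ (hM i x hx)
    rw [h2] at h1
    exact h1

end NormalFunctionals

/-! ### Averages of points of a closed convex set. -/

section Density

variable {G : Type*} [TopologicalSpace G] [MeasurableSpace G] [BorelSpace G]
  (μ : Measure G) [IsFiniteMeasureOnCompacts μ] {u : G → ℝ} (hu : Continuous u)
  (hc : HasCompactSupport u)
  {F : Type*} [NormedAddCommGroup F] [NormedSpace ℝ F] {f : G → F} (hf : Continuous f)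

include hu hc hf in
lemma integrable_density_smul : Integrable (fun g => u g • f g) μ :=
  (hu.smul hf).integrable_of_hasCompactSupport hc.smul_right

include hu hc hf in
lemma integral_density_smul_mem [CompleteSpace F] (hu0 : 0 ≤ u) (hu1 : ∫ g, u g ∂μ = 1)
    {s : Set F} (hs : Convex ℝ s) (hs' : IsClosed s) (hfs : ∀ g, f g ∈ s) :
    ∫ g, u g • f g ∂μ ∈ s := by
  have hmeas : Measurable fun g => (u g).toNNReal := hu.measurable.real_toNNReal
  have hsm : ∀ (g : G) (θ : F), (u g).toNNReal • θ = u g • θ := fun g θ => by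
    rw [NNReal.smul_def, Real.coe_toNNReal _ (hu0 g)]
  have hprob : IsProbabilityMeasure (μ.withDensity fun g => ((u g).toNNReal : ENNReal)) := by
    constructor
    rw [withDensity_apply _ MeasurableSet.univ, Measure.restrict_univ]
    have := ofReal_integral_eq_lintegral_ofReal (hu.integrable_of_hasCompactSupport (μ := μ) hc)
      (Eventually.of_forall hu0)
    rw [hu1, ENNReal.ofReal_one] at this
    exact this.symm
  have e := integral_withDensity_eq_integral_smul (μ := μ) hmeas f
  simp only [hsm] at e
  rw [← e]
  refine hs.integral_mem hs' (Eventually.of_forall hfs) ?_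
  rw [integrable_withDensity_iff_integrable_smul hmeas]
  simp only [hsm]
  exact integrable_density_smul μ hu hc hf

end Density

lemma norm_le_one_of_mem_finiteRankStates {H : Type*} [NormedAddCommGroup H]
    [InnerProductSpace ℂ H] {ω : (H →L[ℂ] H) →L[ℂ] ℂ} (hω : ω ∈ finiteRankStates H) :
    ‖ω‖ ≤ 1 := by
  have hsub : finiteRankStates H ⊆ {ω | ∀ a, ‖ω a‖ ≤ ‖a‖} := by
    refine convexHull_min ?_ fun x hx y hy p q hp hq hpq a => ?_
    · rintro _ ⟨x, hx, rfl⟩ a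
      have := norm_vecFunctional_le x x
      rw [mem_sphere_zero_iff_norm.1 hx, one_mul] at this
      simpa using (vecFunctional x x).le_of_opNorm_le this a
    · change ‖p • x a + q • y a‖ ≤ ‖a‖
      refine (norm_add_le _ _).trans ?_
      rw [norm_smul, norm_smul, Real.norm_of_nonneg hp, Real.norm_of_nonneg hq]
      calc p * ‖x a‖ + q * ‖y a‖ ≤ p * ‖a‖ + q * ‖a‖ := by gcongr; exacts [hx a, hy a]
        _ = ‖a‖ := by rw [← add_mul, hpq, one_mul]
  exact ContinuousLinearMap.opNorm_le_bound _ zero_le_one fun a => by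
    rw [one_mul]; exact hsub hω a

/-! ### Finite rank states almost invariant on compact sets. -/

section AlmostInvariant

variable {H : Type*} [NormedAddCommGroup H] [InnerProductSpace ℂ H] [CompleteSpace H]
  {G : Type*} [Group G] {π : G →* unitary (H →L[ℂ] H)}

lemma vecFunctional_comp_conjAct (x : H) (k : G) :
    (vecFunctional x x).comp (conjAct π k) =
      vecFunctional ((π k⁻¹ : H →L[ℂ] H) x) ((π k⁻¹ : H →L[ℂ] H) x) := by
  ext a
  exact inner_conjAct π k a x

lemma comp_conjAct_mem_normalFunctionals (k : G) {θ : (H →L[ℂ] H) →L[ℂ] ℂ}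
    (hθ : θ ∈ normalFunctionals H) : θ.comp (conjAct π k) ∈ normalFunctionals H := by
  have hle : Submodule.span ℂ (Set.range fun x : H => vecFunctional x x) ≤
      (normalFunctionals H).comap
        (ContinuousLinearMap.precomp ℂ (conjAct π k) :
          ((H →L[ℂ] H) →L[ℂ] ℂ) →L[ℂ] ((H →L[ℂ] H) →L[ℂ] ℂ)).toLinearMap := by
    rw [Submodule.span_le]
    rintro _ ⟨x, rfl⟩
    change (vecFunctional x x).comp (conjAct π k) ∈ normalFunctionals H
    rw [vecFunctional_comp_conjAct]
    exact vecFunctional_mem_normalFunctionals _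
  exact Submodule.topologicalClosure_minimal _ hle
    ((Submodule.isClosed_topologicalClosure _).preimage
      (ContinuousLinearMap.precomp ℂ (conjAct π k)).continuous) hθ

variable [TopologicalSpace G] [IsTopologicalGroup G]
  [MeasurableSpace G] [BorelSpace G]
  (hπ : IsStronglyContinuous π)
  (μ : Measure G) [μ.IsHaarMeasure]
  {u : G → ℝ} (hu : Continuous u) (hc : HasCompactSupport u)

include hπ in
omit [MeasurableSpace G] [BorelSpace G] in
lemma continuous_vecFunctional_rep_inv (x : H) :
    Continuous fun g => vecFunctional ((π g⁻¹ : H →L[ℂ] H) x) ((π g⁻¹ : H →L[ℂ] H) x) :=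
  continuous_vecFunctional_self.comp (hπ.continuous_apply continuous_inv continuous_const)

/-- In the predual the orbit of a vector functional is norm continuous, so this is a Bochner
integral and stays in the closed convex hull of the orbit. -/
lemma vecFunctional_comp_repAverage (x : H) :
    (vecFunctional x x).comp (repAverage hπ μ hu hc) =
      ∫ g, u g • vecFunctional ((π g⁻¹ : H →L[ℂ] H) x) ((π g⁻¹ : H →L[ℂ] H) x) ∂μ := by
  have hint := integrable_density_smul μ hu hc (continuous_vecFunctional_rep_inv hπ x)
  ext a
  rw [ContinuousLinearMap.integral_apply hint, ContinuousLinearMap.comp_apply,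
    vecFunctional_apply, inner_repAverage]
  simp only [inner_conjAct]
  rfl

variable (hu0 : 0 ≤ u) (hu1 : ∫ g, u g ∂μ = 1)
include hu0 hu1

lemma vecFunctional_comp_repAverage_mem {x : H} (hx : ‖x‖ = 1) :
    (vecFunctional x x).comp (repAverage hπ μ hu hc) ∈ closure (finiteRankStates H) := by
  rw [vecFunctional_comp_repAverage]
  refine integral_density_smul_mem μ hu hc (continuous_vecFunctional_rep_inv hπ x) hu0 hu1
    (convex_convexHull ℝ _).closure isClosed_closure fun g => ?_
  exact subset_closure (subset_convexHull ℝ _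
    ⟨_, mem_sphere_zero_iff_norm.2 ((norm_rep_apply π _ x).trans hx), rfl⟩)

lemma comp_repAverage_mem_closure {ω : (H →L[ℂ] H) →L[ℂ] ℂ} (hω : ω ∈ finiteRankStates H) :
    ω.comp (repAverage hπ μ hu hc) ∈ closure (finiteRankStates H) := by
  let R : ((H →L[ℂ] H) →L[ℂ] ℂ) →L[ℂ] ((H →L[ℂ] H) →L[ℂ] ℂ) :=
    ContinuousLinearMap.precomp ℂ (repAverage hπ μ hu hc)
  have hconv : Convex ℝ (R ⁻¹' closure (finiteRankStates H)) :=
    (convex_convexHull ℝ _).closure.is_linear_preimage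
      ⟨fun x y => R.map_add x y, fun c x => R.map_smul_of_tower c x⟩
  refine convexHull_min ?_ hconv hω
  rintro _ ⟨x, hx, rfl⟩
  exact vecFunctional_comp_repAverage_mem hπ μ hu hc hu0 hu1 (by simpa using hx)

variable [LocallyCompactSpace G] [μ.InnerRegular]

/-- An invariant state is approximated by finite rank states which are uniformly almost invariant
on compact sets and almost vanish on an operator whose average is annihilated by the state. -/
lemma exists_almost_invariant_finiteRankState {φ : (H →L[ℂ] H) →L[ℂ] ℂ}
    (hφ0 : ∀ a, 0 ≤ a → 0 ≤ φ a) (hφ1 : φ 1 = 1) (hφ : ∀ g a, φ (conjAct π g a) = φ a)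
    {P : H →L[ℂ] H} (hP : φ (repAverage hπ μ hu hc P) = 0) {K : Set G} (hK : IsCompact K)
    {ε : ℝ} (hε : 0 < ε) :
    ∃ ω ∈ finiteRankStates H, ‖ω P‖ ≤ ε ∧ ∀ k ∈ K, ∀ a, ‖ω (conjAct π k a) - ω a‖ ≤ ε * ‖a‖ := by
  set A := repAverage hπ μ hu hc
  obtain ⟨x₀, hx₀⟩ : ∃ x : H, ‖x‖ = 1 := by
    have : Nontrivial H := by
      by_contra hcon
      rw [not_nontrivial_iff_subsingleton] at hcon
      have : (1 : H →L[ℂ] H) = 0 := by ext x; exact Subsingleton.elim _ _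
      rw [this, map_zero] at hφ1
      exact zero_ne_one hφ1
    exact exists_norm_eq H zero_le_one
  -- Almost invariance takes four steps of size δ‖a‖; the value at `P` costs δ‖P‖ + δ.
  set δ := ε / (4 * (‖P‖ + 1)) with hδ_def
  have hδ : 0 < δ := by positivity
  have hδε : 4 * δ ≤ ε := by
    rw [hδ_def, mul_div_assoc', mul_div_mul_left _ _ (by norm_num : (4 : ℝ) ≠ 0)]
    exact div_le_self hε.le (by linarith [norm_nonneg P])
  have hδP : δ * ‖P‖ + δ ≤ ε := by
    have : δ * ‖P‖ + δ = ε / 4 := by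
      rw [hδ_def]; field_simp
    linarith
  have hU := tendsto_repAverage_conjAct hπ μ hu hc hδ
  obtain ⟨t, htK, hcov⟩ := hK.elim_nhds_subcover
    (fun k => {g | ∀ a : H →L[ℂ] H, ‖A (conjAct π (g * k⁻¹) a) - A a‖ ≤ δ * ‖a‖}) fun k _ => by
      have := (continuous_mul_const k⁻¹).tendsto k
      rw [mul_inv_cancel] at this
      exact this.eventually hU
  -- The rank one map at `none` encodes smallness of ω(A P) as a norm condition, tested at the
  -- operator 1. The other maps encode invariance under the finitely many centres of the cover.
  let M : Option t → (H →L[ℂ] H) →L[ℂ] (H →L[ℂ] H) := fun i =>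
    i.elim ((vecFunctional x₀ x₀).smulRight (A P)) fun k => A.comp (conjAct π (k : G)) - A
  have hN : ∀ x : H, ‖x‖ = 1 → (vecFunctional x x).comp A ∈ normalFunctionals H := fun x hx =>
    closure_finiteRankStates_subset (vecFunctional_comp_repAverage_mem hπ μ hu hc hu0 hu1 hx)
  obtain ⟨ω, hω, hωM⟩ := exists_finiteRankState_norm_comp_lt hφ0 hφ1 M
    (by
      rintro (_ | k) x hx
      · have : (vecFunctional x x).comp (M none) =
            (vecFunctional x x (A P)) • vecFunctional x₀ x₀ := by
          ext a
          simp [M, mul_comm]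
        rw [this]
        exact Submodule.smul_mem _ _ (vecFunctional_mem_normalFunctionals _)
      · have : (vecFunctional x x).comp (M (some k)) =
            ((vecFunctional x x).comp A).comp (conjAct π (k : G)) - (vecFunctional x x).comp A := by
          ext a
          simp [M]
        rw [this]
        exact Submodule.sub_mem _ (comp_conjAct_mem_normalFunctionals _ (hN x hx)) (hN x hx))
    (by
      rintro (_ | k) b
      · simp [M, hP]
      · have := apply_repAverage_conjAct μ hπ hu hc hu1 hφ k b
        simp [M, A, this])
    hδ
  -- ω ∘ A is only a norm limit of convex combinations of vector states, so a nearby combination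
  -- replaces it.
  obtain ⟨ω', hω', hlt⟩ := Metric.mem_closure_iff.1
    (comp_repAverage_mem_closure hπ μ hu hc hu0 hu1 hω) δ hδ
  rw [dist_eq_norm] at hlt
  have hω1 := norm_le_one_of_mem_finiteRankStates hω
  have happ : ∀ a, ‖ω (A a) - ω' a‖ ≤ δ * ‖a‖ := fun a =>
    (ContinuousLinearMap.le_opNorm (ω.comp A - ω') a).trans
      (mul_le_mul_of_nonneg_right hlt.le (norm_nonneg a))
  refine ⟨ω', hω', ?_, fun k hk a => ?_⟩
  · have h1 : ‖ω (A P)‖ ≤ δ := by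
      have h2 := (ContinuousLinearMap.le_opNorm (ω.comp (M none)) 1).trans
        (mul_le_mul_of_nonneg_right (hωM none).le (norm_nonneg _))
      have h3 : (ω.comp (M none)) 1 = ω (A P) := by
        have : vecFunctional x₀ x₀ 1 = 1 := by
          rw [vecFunctional_apply, one_apply_eq_self, inner_self_eq_norm_sq_to_K, hx₀]; simp
        simp [M, this]
      rw [h3] at h2
      refine h2.trans (mul_le_of_le_one_right hδ.le ?_)
      exact ContinuousLinearMap.opNorm_le_bound _ zero_le_one fun x => by simp
    have h4 := norm_sub_norm_le (ω' P) (ω (A P))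
    have h5 := happ P
    rw [norm_sub_rev] at h5
    linarith
  · obtain ⟨k₀, hk₀, hkk⟩ := Set.mem_iUnion₂.1 (hcov hk)
    have h1 := happ (conjAct π k a)
    have h2 := happ a
    have h3 : ‖ω (A (conjAct π k a)) - ω (A (conjAct π k₀ a))‖ ≤ δ * ‖a‖ := by
      rw [← map_sub]
      refine (ω.le_of_opNorm_le hω1 _).trans ?_
      rw [one_mul]
      have h4 := hkk (conjAct π k₀ a)
      rw [← conjAct_mul, inv_mul_cancel_right] at h4
      exact h4.trans (mul_le_mul_of_nonneg_left (norm_conjAct_apply_le π _ _) hδ.le)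
    have h4 : ‖ω (A (conjAct π k₀ a)) - ω (A a)‖ ≤ δ * ‖a‖ := by
      have := (ContinuousLinearMap.le_opNorm (ω.comp (M (some ⟨k₀, hk₀⟩))) a).trans
        (mul_le_mul_of_nonneg_right (hωM _).le (norm_nonneg _))
      simpa [M] using this
    have h5 : δ * ‖conjAct π k a‖ ≤ δ * ‖a‖ :=
      mul_le_mul_of_nonneg_left (norm_conjAct_apply_le π _ _) hδ.le
    have h6 : 4 * δ * ‖a‖ ≤ ε * ‖a‖ := mul_le_mul_of_nonneg_right hδε (norm_nonneg _)
    rw [← dist_eq_norm] at h1 h2 h3 h4 ⊢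
    rw [dist_comm] at h1
    linarith [dist_triangle4 (ω' (conjAct π k a)) (ω (A (conjAct π k a))) (ω (A (conjAct π k₀ a)))
      (ω (A a)), dist_triangle (ω' (conjAct π k a)) (ω (A a)) (ω' a)]

end AlmostInvariant

/-! ### Diagonalising finite rank states. -/

section Diagonalization

variable {H : Type*} [NormedAddCommGroup H] [InnerProductSpace ℂ H]

lemma exists_sum_inner_of_mem_finiteRankStates {ω : (H →L[ℂ] H) →L[ℂ] ℂ}
    (hω : ω ∈ finiteRankStates H) :
    ∃ (ι : Type) (_ : Fintype ι) (y : ι → H), ∑ i, ‖y i‖ ^ 2 = 1 ∧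
      ∀ a, ω a = ∑ i, inner ℂ (y i) (a (y i)) := by
  obtain ⟨ι, hι, w, z, hw0, hw1, hz, rfl⟩ := mem_convexHull_iff_exists_fintype.1 hω
  choose x hx hxz using hz
  refine ⟨ι, hι, fun i => (√(w i) : ℂ) • x i, ?_, fun a => ?_⟩
  · rw [← hw1]
    refine Finset.sum_congr rfl fun i _ => ?_
    rw [norm_smul, mem_sphere_zero_iff_norm.1 (hx i)]
    simp [Real.sq_sqrt (hw0 i)]
  · rw [sum_apply]
    refine Finset.sum_congr rfl fun i _ => ?_
    rw [← hxz i, map_smul, inner_smul_left, inner_smul_right, ← mul_assoc, Complex.conj_ofReal,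
      ← Complex.ofReal_mul, Real.mul_self_sqrt (hw0 i)]
    rfl

/-- Spectral decomposition of a positive functional of finite rank. -/
lemma exists_orthonormal_sum_inner_eq {ι : Type*} [Fintype ι] (z : ι → H) :
    ∃ (n : ℕ) (e : Fin n → H) (p : Fin n → ℝ), Orthonormal ℂ e ∧
      (∀ i, e i ∈ Submodule.span ℂ (Set.range z)) ∧ (∀ i, 0 ≤ p i) ∧
      ∀ a : H →L[ℂ] H, ∑ j, inner ℂ (z j) (a (z j)) = ∑ i, (p i : ℂ) * inner ℂ (e i) (a (e i)) := by
  set W := Submodule.span ℂ (Set.range z)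
  have : FiniteDimensional ℂ W := FiniteDimensional.span_of_finite ℂ (Set.finite_range z)
  have hz : ∀ j, z j ∈ W := fun j => Submodule.subset_span ⟨j, rfl⟩
  -- The functional is a ↦ tr(aT), with a compressed to `W`, so an eigenbasis of T diagonalises it.
  let T : W →L[ℂ] W :=
    ∑ j, InnerProductSpace.rankOne ℂ (⟨z j, hz j⟩ : W) (⟨z j, hz j⟩ : W)
  have hT : T.toLinearMap.IsPositive := (ContinuousLinearMap.isPositive_toLinearMap_iff T).2
    (ContinuousLinearMap.isPositive_sum _ fun _ _ => InnerProductSpace.isPositive_rankOne_self _)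
  have hTapply : ∀ w : W, ((T w : W) : H) = ∑ j, (inner ℂ (z j) (w : H) : ℂ) • z j := fun w => by
    simp [T, sum_apply]
  let b := hT.isSymmetric.eigenvectorBasis rfl
  let p := hT.isSymmetric.eigenvalues rfl
  have hexp : ∀ j v, inner ℂ (z j) v = ∑ i, inner ℂ (z j) (b i : H) * inner ℂ (b i : H) v := by
    intro j v
    have h := congrArg (Subtype.val) (b.sum_repr' ⟨z j, hz j⟩)
    have h' : z j = ∑ i, (inner ℂ (b i : H) (z j) : ℂ) • (b i : H) := by
      simpa using h.symm
    conv_lhs => rw [h']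
    rw [sum_inner]
    refine Finset.sum_congr rfl fun i _ => ?_
    rw [inner_smul_left, inner_conj_symm]
  refine ⟨_, fun i => b i, p, b.orthonormal.comp_linearIsometry W.subtypeₗᵢ, fun i => (b i).2,
    fun i => hT.nonneg_eigenvalues rfl i, fun a => ?_⟩
  calc ∑ j, inner ℂ (z j) (a (z j))
      = ∑ i, inner ℂ (b i : H) (a ((T (b i) : W) : H)) := by
        simp only [hTapply, map_sum, map_smul, inner_sum, inner_smul_right]
        rw [Finset.sum_comm]
        exact Finset.sum_congr rfl fun j _ => hexp j _
    _ = _ := by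
        refine Finset.sum_congr rfl fun i _ => ?_
        have : T (b i) = (p i : ℂ) • b i := hT.isSymmetric.apply_eigenvectorBasis rfl i
        rw [this, Submodule.coe_smul, map_smul, inner_smul_right]

lemma norm_inner_apply_sub_inner_apply_le (a : H →L[ℂ] H) {y z : H} (hz : ‖z‖ ≤ ‖y‖) :
    ‖inner ℂ y (a y) - inner ℂ z (a z)‖ ≤ 2 * (‖y - z‖ * ‖y‖) * ‖a‖ := by
  have e : inner ℂ y (a y) - inner ℂ z (a z) =
      vecFunctional (y - z) y a + vecFunctional z (y - z) a := by
    simp only [vecFunctional_apply, map_sub, inner_sub_left, inner_sub_right]; ring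
  rw [e]
  refine (norm_add_le _ _).trans ?_
  have h1 := (vecFunctional (y - z) y).le_of_opNorm_le (norm_vecFunctional_le _ _) a
  have h2 := (vecFunctional z (y - z)).le_of_opNorm_le (norm_vecFunctional_le _ _) a
  have h3 : ‖z‖ * ‖y - z‖ * ‖a‖ ≤ ‖y‖ * ‖y - z‖ * ‖a‖ := by gcongr
  linarith

/-- Compression of a finite rank state to the orthogonal complement of a subspace. -/
lemma exists_weights_orthogonal {ω : (H →L[ℂ] H) →L[ℂ] ℂ} (hω : ω ∈ finiteRankStates H)
    (V : Submodule ℂ H) [V.HasOrthogonalProjection] {δ : ℝ} (hδ : 0 ≤ δ)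
    (hV : ‖ω V.starProjection‖ ≤ δ ^ 2) :
    ∃ (n : ℕ) (e : Fin n → H) (p : Fin n → ℝ), Orthonormal ℂ e ∧ (∀ i, e i ∈ Vᗮ) ∧
      (∀ i, 0 ≤ p i) ∧
      ∀ a : H →L[ℂ] H, ‖ω a - ∑ i, (p i : ℂ) * inner ℂ (e i) (a (e i))‖ ≤ 2 * δ * ‖a‖ := by
  obtain ⟨ι, _, y, hy1, hy⟩ := exists_sum_inner_of_mem_finiteRankStates hω
  obtain ⟨n, e, p, he, hespan, hp, hsum⟩ :=
    exists_orthonormal_sum_inner_eq fun i => y i - V.starProjection (y i)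
  have hmem : ∀ i, y i - V.starProjection (y i) ∈ Vᗮ := fun i =>
    V.sub_starProjection_mem_orthogonal (y i)
  refine ⟨n, e, p, he, fun i => Submodule.span_le.2 ?_ (hespan i), hp, fun a => ?_⟩
  · rintro _ ⟨i, rfl⟩
    exact hmem i
  have hPy : ∑ i, ‖V.starProjection (y i)‖ ^ 2 ≤ δ ^ 2 := by
    have h1 : ω V.starProjection = ((∑ i, ‖V.starProjection (y i)‖ ^ 2 : ℝ) : ℂ) := by
      rw [hy, Complex.ofReal_sum]
      refine Finset.sum_congr rfl fun i _ => ?_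
      have : inner ℂ (y i) (V.starProjection (y i)) =
          inner ℂ (V.starProjection (y i)) (V.starProjection (y i)) := by
        have h2 := V.inner_right_of_mem_orthogonal (V.starProjection_apply_mem (y i)) (hmem i)
        rw [inner_sub_right, sub_eq_zero] at h2
        rw [← inner_conj_symm, h2, inner_conj_symm]
      rw [this, inner_self_eq_norm_sq_to_K]
      norm_cast
    rw [h1, Complex.norm_real, Real.norm_of_nonneg (Finset.sum_nonneg fun i _ => sq_nonneg _)] at hV
    exact hV
  have hzy : ∀ i, ‖y i - V.starProjection (y i)‖ ≤ ‖y i‖ := fun i => by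
    rw [← Submodule.starProjection_orthogonal_val]
    exact Vᗮ.norm_starProjection_apply_le (y i)
  rw [hy, ← hsum, ← Finset.sum_sub_distrib]
  refine (norm_sum_le _ _).trans ?_
  calc _ ≤ ∑ i, 2 * (‖V.starProjection (y i)‖ * ‖y i‖) * ‖a‖ := by
        refine Finset.sum_le_sum fun i _ => ?_
        simpa using norm_inner_apply_sub_inner_apply_le a (hzy i)
    _ = 2 * (∑ i, ‖V.starProjection (y i)‖ * ‖y i‖) * ‖a‖ := by
        rw [Finset.mul_sum, Finset.sum_mul]
    _ ≤ 2 * δ * ‖a‖ := by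
        gcongr
        -- Cauchy–Schwarz with ∑ ‖y i‖² = 1; it is the reason for the square in `hV`.
        refine (Real.sum_mul_le_sqrt_mul_sqrt _ _ _).trans ?_
        rw [hy1, Real.sqrt_one, mul_one]
        exact Real.sqrt_le_iff.2 ⟨hδ, hPy⟩

end Diagonalization

/-! ### Finite-dimensional invariant subspaces from states. -/

section InvariantSubspace

open InnerProductSpace

variable {H : Type*} [NormedAddCommGroup H] [InnerProductSpace ℂ H]

/-- The operator `T` with `⟪T v, w⟫ = φ(|w⟩⟨v|)` representing the normal part of `φ`. -/
lemma exists_density_operator [CompleteSpace H] (φ : (H →L[ℂ] H) →L[ℂ] ℂ) :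
    ∃ T : H →L[ℂ] H, ∀ v w, inner ℂ (T v) w = φ (rankOne ℂ w v) := by
  let B : H →L⋆[ℂ] H →L[ℂ] ℂ :=
    (LinearMap.mk₂'ₛₗ (starRingEnd ℂ) (RingHom.id ℂ) (fun v w => φ (rankOne ℂ w v))
      (fun x x' y => by simp)
      (fun c x y => by simp)
      (fun x y y' => by simp)
      (fun c x y => by simp)).mkContinuous₂ ‖φ‖ fun x y => by
      rw [mul_assoc, mul_comm ‖x‖]
      exact φ.le_opNorm_of_le (norm_rankOne (𝕜 := ℂ) y x).le
  exact ⟨continuousLinearMapOfBilin B, fun v w => continuousLinearMapOfBilin_apply B v w⟩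

lemma exists_submodule_finrank_eq_of_not_finiteDimensional {W : Submodule ℂ H}
    (hW : ¬ FiniteDimensional ℂ W) (n : ℕ) :
    ∃ (U : Submodule ℂ H) (_ : FiniteDimensional ℂ U), U ≤ W ∧ Module.finrank ℂ U = n := by
  have h1 : (n : Cardinal) ≤ Module.rank ℂ W :=
    (Cardinal.natCast_lt_aleph0.le).trans (not_lt.1 fun h => hW (Module.rank_lt_aleph0_iff.1 h))
  obtain ⟨s, hs, hli⟩ := le_rank_iff_exists_linearIndependent_finset.1 h1
  refine ⟨(Submodule.span ℂ (s : Set W)).map W.subtype, inferInstance, ?_, ?_⟩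
  · exact Submodule.map_subtype_le _ _
  · rw [Submodule.finrank_map_subtype_eq, finrank_span_finset_eq_card hli, hs]

variable [CompleteSpace H] {φ : (H →L[ℂ] H) →L[ℂ] ℂ} (hφ0 : ∀ a, 0 ≤ a → 0 ≤ φ a)

omit [CompleteSpace H] in
lemma apply_starProjection_eq_sum (U : Submodule ℂ H) [FiniteDimensional ℂ U] :
    φ U.starProjection = ∑ i, φ (rankOne ℂ (stdOrthonormalBasis ℂ U i : H)
      (stdOrthonormalBasis ℂ U i : H)) := by
  rw [(stdOrthonormalBasis ℂ U).starProjection_eq_sum_rankOne, map_sum]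

include hφ0 in
lemma re_apply_starProjection_le_one (hφ1 : φ 1 = 1) (U : Submodule ℂ H)
    [FiniteDimensional ℂ U] : (φ U.starProjection).re ≤ 1 := by
  have h := hφ0 _ (isStarProjection_starProjection (U := Uᗮ)).nonneg
  have e : Uᗮ.starProjection = 1 - U.starProjection := by
    ext x
    rw [Submodule.starProjection_orthogonal_val]
    rfl
  rw [e, map_sub, hφ1, Complex.nonneg_iff] at h
  have := h.1
  rw [Complex.sub_re, Complex.one_re] at this
  linarith

omit [CompleteSpace H] in
include hφ0 in
lemma density_operator_nonneg {T : H →L[ℂ] H}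
    (hT : ∀ v w, inner ℂ (T v) w = φ (rankOne ℂ w v)) : 0 ≤ T := by
  rw [ContinuousLinearMap.nonneg_iff_isPositive, ContinuousLinearMap.isPositive_iff_complex]
  intro x
  have h := hφ0 _ ((ContinuousLinearMap.nonneg_iff_isPositive _).2
    (isPositive_rankOne_self (𝕜 := ℂ) x))
  rw [← hT, Complex.nonneg_iff] at h
  exact ⟨Complex.ext rfl (by simpa using h.2), h.1⟩

include hφ0 in
-- An n-dimensional subspace U of `W` satisfies nδ ≤ Re φ(P_U) ≤ 1, where P_U is its projection, so
-- n ≤ 1/δ.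
lemma finiteDimensional_of_density_operator_ge (hφ1 : φ 1 = 1) {T : H →L[ℂ] H}
    (hT : ∀ v w, inner ℂ (T v) w = φ (rankOne ℂ w v)) {δ : ℝ} (hδ : 0 < δ) {W : Submodule ℂ H}
    (hW : ∀ x ∈ W, δ * ‖x‖ ^ 2 ≤ (inner ℂ (T x) x).re) : FiniteDimensional ℂ W := by
  by_contra hcon
  obtain ⟨n, hn⟩ := exists_nat_gt δ⁻¹
  obtain ⟨U, hU, hUW, hfin⟩ := exists_submodule_finrank_eq_of_not_finiteDimensional hcon n
  have h1 := re_apply_starProjection_le_one hφ0 hφ1 U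
  rw [apply_starProjection_eq_sum, Complex.re_sum] at h1
  have h2 : ∀ i, δ ≤ (φ (rankOne ℂ (stdOrthonormalBasis ℂ U i : H)
      (stdOrthonormalBasis ℂ U i : H))).re := fun i => by
    rw [← hT]
    have h3 := hW _ (hUW (stdOrthonormalBasis ℂ U i).2)
    have h4 : ‖(stdOrthonormalBasis ℂ U i : H)‖ = 1 := (stdOrthonormalBasis ℂ U).orthonormal.1 i
    rwa [h4, one_pow, mul_one] at h3
  have h3 := (Finset.sum_le_sum fun i _ => h2 i).trans h1
  rw [Finset.sum_const, Finset.card_univ, Fintype.card_fin, hfin, nsmul_eq_mul] at h3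
  rw [inv_lt_iff_one_lt_mul₀ hδ] at hn
  linarith

include hφ0 in
/-- An invariant state which does not vanish on the operators of finite rank gives rise to a
finite-dimensional invariant subspace. -/
lemma exists_invariant_submodule_of_apply_rankOne_ne_zero (hφ1 : φ 1 = 1) {G : Type*} [Group G]
    {π : G →* unitary (H →L[ℂ] H)} (hφ : ∀ g a, φ (conjAct π g a) = φ a)
    {x y : H} (hxy : φ (rankOne ℂ x y) ≠ 0) :
    ∃ W : Submodule ℂ H, FiniteDimensional ℂ W ∧ W ≠ ⊥ ∧
      ∀ g, ∀ w ∈ W, (π g : H →L[ℂ] H) w ∈ W := by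
  obtain ⟨T, hT⟩ := exists_density_operator φ
  have hTpos := density_operator_nonneg hφ0 hT
  have hTsa : IsSelfAdjoint T := .of_nonneg hTpos
  have hT0 : T ≠ 0 := by
    rintro rfl
    exact hxy (by rw [← hT]; simp)
  have hcomm : ∀ g, Commute T (π g : H →L[ℂ] H) := fun g => by
    ext v
    refine ext_inner_right ℂ fun w => ?_
    change inner ℂ (T ((π g : H →L[ℂ] H) v)) w = inner ℂ ((π g : H →L[ℂ] H) (T v)) w
    rw [inner_rep_left, hT, hT, ← hφ g (rankOne ℂ _ v)]
    congr 1
    ext z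
    rw [conjAct_apply_apply, rankOne_apply, rankOne_apply, map_smul, rep_apply_inv_self,
      inner_rep_left]
  -- The positive part of t − δ is a continuous substitute for the spectral projection onto (δ, ∞):
  -- T ≥ δ on the range of `cfc f T`.
  set δ := ‖T‖ / 2 with hδ_def
  have hδ : 0 < δ := half_pos (norm_pos_iff.2 hT0)
  set f : ℝ → ℝ := fun t => max (t - δ) 0 with hf_def
  have hf : Continuous f := by fun_prop
  have hidT : cfc (fun t : ℝ => t) T = T := cfc_id' ℝ T
  refine ⟨LinearMap.range (cfc f T).toLinearMap, ?_, fun hbot => ?_, ?_⟩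
  · refine finiteDimensional_of_density_operator_ge hφ0 hφ1 hT hδ ?_
    rintro _ ⟨z, rfl⟩
    have hpos : 0 ≤ cfc (fun t => f t * (t - δ) * f t) T := by
      refine cfc_nonneg fun t _ => ?_
      simp only [hf_def]
      rcases le_total (t - δ) 0 with h | h
      · simp [max_eq_right h]
      · rw [max_eq_left h]; positivity
    have e : cfc (fun t => f t * (t - δ) * f t) T =
        cfc f T * (T - algebraMap ℝ _ δ) * cfc f T := by
      rw [cfc_mul (fun t => f t * (t - δ)) f T, cfc_mul f (fun t => t - δ) T,
        cfc_sub (fun t => t) (fun _ => δ) T, hidT, cfc_const δ T]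
    rw [e] at hpos
    have h := ((ContinuousLinearMap.nonneg_iff_isPositive _).1 hpos).re_inner_nonneg_left z
    have hsymm : ∀ v w, inner ℂ (cfc f T v) w = inner ℂ v (cfc f T w) :=
      (ContinuousLinearMap.isSelfAdjoint_iff_isSymmetric.1 (cfc_predicate f T))
    change 0 ≤ (inner ℂ (cfc f T ((T - algebraMap ℝ (H →L[ℂ] H) δ) (cfc f T z))) z).re at h
    rw [hsymm, sub_apply, inner_sub_left, Algebra.algebraMap_eq_smul_one, smul_apply,
      one_apply_eq_self, ← Complex.coe_smul, inner_smul_left, Complex.conj_ofReal, Complex.sub_re,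
      Complex.re_ofReal_mul, inner_self_eq_norm_sq_to_K] at h
    change δ * ‖cfc f T z‖ ^ 2 ≤ (inner ℂ (T (cfc f T z)) (cfc f T z)).re
    have h5 : (((‖cfc f T z‖ : ℝ) : ℂ) ^ 2).re = ‖cfc f T z‖ ^ 2 := by norm_cast
    have h6 := h
    erw [h5] at h6
    linarith
  · have h0 : cfc f T = 0 := by
      ext z
      have : cfc f T z ∈ LinearMap.range (cfc f T).toLinearMap := ⟨z, rfl⟩
      rw [hbot, Submodule.mem_bot] at this
      exact this
    -- If f(T) vanished, t ≤ f(t) + δ would give ‖T‖ ≤ ‖T‖ / 2.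
    have h1 : T ≤ algebraMap ℝ (H →L[ℂ] H) δ := by
      have h2 : cfc (fun t : ℝ => t) T ≤ cfc (fun t => f t + δ) T := cfc_mono fun t _ => by
        have := le_max_left (t - δ) 0
        simp only [hf_def]; linarith
      rw [hidT, cfc_add_const δ f T, h0, zero_add] at h2
      exact h2
    have h2 := (CStarAlgebra.norm_le_iff_le_algebraMap T hδ.le hTpos).2 h1
    linarith
  · rintro g _ ⟨z, rfl⟩
    refine ⟨(π g : H →L[ℂ] H) z, ?_⟩
    have := ((hcomm g).cfc_real f).eq
    exact congrArg (fun S : H →L[ℂ] H => S z) this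

end InvariantSubspace

/-! ### Charges from weights on orthonormal vectors. -/

section Charge

open InnerProductSpace

variable {H : Type*} [NormedAddCommGroup H] [InnerProductSpace ℂ H] [CompleteSpace H]

/-- All families must lie in one orthonormal set, so that one Hilbert basis extending it carries
every weight. -/
lemma exists_basis_charge_tendsto {S : Set H} (hS : Orthonormal ℂ ((↑) : S → H)) {d : ℕ → ℕ}
    (e : ∀ n, Fin (d n) → H) (heS : ∀ n i, e n i ∈ S) (p : ∀ n, Fin (d n) → ℝ)
    (hp : ∀ n i, 0 ≤ p n i) (hp1 : ∀ n, ∑ i, p n i = 1) :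
    ∃ X : Set H, IsOrthonormalBasis X ∧ ∃ μ : ProbabilityCharge (Set X), ∀ a : H →L[ℂ] H,
      Tendsto (fun n => ∑ i, (p n i : ℂ) * inner ℂ (e n i) (a (e n i))) (hyperfilter ℕ)
        (𝓝 (inducedFunctional X μ a)) := by
  obtain ⟨X, b, hSX, hb⟩ := hS.exists_hilbertBasis_extension
  have hX : Orthonormal ℂ ((↑) : X → H) := hb ▸ b.orthonormal
  obtain ⟨μ, hμ⟩ := ProbabilityCharge.exists_charge_tendsto_integral
    (fun n i => (⟨e n i, hSX (heS n i)⟩ : X)) p hp hp1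
  refine ⟨X, ⟨hX, ?_⟩, μ, fun a => hμ (fun x => inner ℂ (x : H) (a (x : H))) ‖a‖ fun x => ?_⟩
  · have := b.dense_span
    rwa [hb, Subtype.range_coe] at this
  · refine (norm_inner_le_norm _ _).trans ?_
    have := a.le_opNorm (x : H)
    rw [hX.1 x] at this ⊢
    simpa using this

variable {G : Type*} [Group G] {π : G →* unitary (H →L[ℂ] H)}

/-- If the weights `p n` on the orthonormal vectors `e n` define asymptotically invariant
functionals, then a limit charge defines an invariant functional. -/
lemma exists_basis_invariant_charge {S : Set H} (hS : Orthonormal ℂ ((↑) : S → H)) {d : ℕ → ℕ}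
    (e : ∀ n, Fin (d n) → H) (heS : ∀ n i, e n i ∈ S) (p : ∀ n, Fin (d n) → ℝ)
    (hp : ∀ n i, 0 ≤ p n i) (hp1 : ∀ n, ∑ i, p n i = 1)
    (hinv : ∀ g a, Tendsto (fun n => ∑ i, (p n i : ℂ) * inner ℂ (e n i) (conjAct π g a (e n i)) -
      ∑ i, (p n i : ℂ) * inner ℂ (e n i) (a (e n i))) atTop (𝓝 0)) :
    ∃ X : Set H, IsOrthonormalBasis X ∧
      ∃ μ : ProbabilityCharge (Set X), IsRepInvariant π (inducedFunctional X μ) := by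
  obtain ⟨X, hX, μ, hμ⟩ := exists_basis_charge_tendsto hS e heS p hp hp1
  refine ⟨X, hX, μ, (isRepInvariant_iff π).2 fun g a => ?_⟩
  have h1 := (hμ (conjAct π g a)).sub (hμ a)
  have h2 := (hinv g a).mono_left Nat.hyperfilter_le_atTop
  exact sub_eq_zero.1 (tendsto_nhds_unique h1 h2)

/-- Both sides are the trace of the compression of `a` to `W`, computed in the basis `b` and in its
image under π(g⁻¹). -/
lemma sum_inner_conjAct_eq {W : Submodule ℂ H} [FiniteDimensional ℂ W]
    (hW : ∀ g, ∀ w ∈ W, (π g : H →L[ℂ] H) w ∈ W) {ι : Type*} [Fintype ι]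
    (b : OrthonormalBasis ι ℂ W) (g : G) (a : H →L[ℂ] H) :
    ∑ i, inner ℂ (b i : H) (conjAct π g a (b i : H)) = ∑ i, inner ℂ (b i : H) (a (b i : H)) := by
  let f : W →ₗᵢ[ℂ] W :=
    { toLinearMap := (π g⁻¹ : H →L[ℂ] H).toLinearMap.restrict (hW g⁻¹)
      norm_map' := fun x => norm_rep_apply π g⁻¹ (x : H) }
  let b' := b.map (f.toLinearIsometryEquiv rfl)
  have hb' : ∀ i, (b' i : H) = (π g⁻¹ : H →L[ℂ] H) (b i : H) := fun i => by
    simp [b', f]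
  let T : W →ₗ[ℂ] W :=
    (W.orthogonalProjectionOnto.comp (a.comp W.subtypeL)).toLinearMap
  have hT : ∀ w : W, inner ℂ w (T w) = inner ℂ (w : H) (a (w : H)) := fun w => by
    exact Submodule.inner_orthogonalProjectionOnto_eq_of_mem_left w _
  have h1 := T.trace_eq_sum_inner b
  have h2 := T.trace_eq_sum_inner b'
  simp only [hT] at h1 h2
  rw [← h1, h2]
  exact Finset.sum_congr rfl fun i _ => by rw [inner_conjAct, hb']

/-- The limit is taken of the constant sequence of uniform weights on an orthonormal basis of `W`.
-/
lemma exists_invariant_charge_of_invariant_submodule {W : Submodule ℂ H}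
    (hfin : FiniteDimensional ℂ W) (hW0 : W ≠ ⊥)
    (hW : ∀ g, ∀ w ∈ W, (π g : H →L[ℂ] H) w ∈ W) :
    ∃ X : Set H, IsOrthonormalBasis X ∧
      ∃ μ : ProbabilityCharge (Set X), IsRepInvariant π (inducedFunctional X μ) := by
  let b := stdOrthonormalBasis ℂ W
  have hpos : 0 < Module.finrank ℂ W := by
    have := Submodule.nontrivial_iff_ne_bot.2 hW0
    exact Module.finrank_pos
  have hb : Orthonormal ℂ fun i => (b i : H) := b.orthonormal.comp_linearIsometry W.subtypeₗᵢ
  refine exists_basis_invariant_charge hb.toSubtypeRange (d := fun _ => Module.finrank ℂ W)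
    (fun _ i => (b i : H)) (fun _ i => ⟨i, rfl⟩) (fun _ _ => (Module.finrank ℂ W : ℝ)⁻¹)
    (fun _ _ => by positivity) (fun _ => ?_) fun g a => ?_
  · rw [Finset.sum_const, Finset.card_univ, Fintype.card_fin, nsmul_eq_mul,
      mul_inv_cancel₀ (by positivity)]
  · simp only [← Finset.mul_sum, sum_inner_conjAct_eq hW b g a, sub_self, tendsto_const_nhds]

end Charge

/-! ### The case without finite-dimensional invariant subspaces. -/

section WeaklyMixing

open InnerProductSpace

variable {H : Type*} [NormedAddCommGroup H] [InnerProductSpace ℂ H] [CompleteSpace H]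
  {G : Type*} [Group G] [TopologicalSpace G] [IsTopologicalGroup G]
  [LocallyCompactSpace G] {π : G →* unitary (H →L[ℂ] H)} (hπ : IsStronglyContinuous π)
  {φ : (H →L[ℂ] H) →L[ℂ] ℂ} (hφ0 : ∀ a, 0 ≤ a → 0 ≤ φ a) (hφ1 : φ 1 = 1)
  (hφ : ∀ g a, φ (conjAct π g a) = φ a)
  (hmix : ∀ W : Submodule ℂ H, FiniteDimensional ℂ W →
    (∀ g, ∀ w ∈ W, (π g : H →L[ℂ] H) w ∈ W) → W = ⊥)
include hπ hφ0 hφ1 hφ hmix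

lemma exists_orthonormal_almost_invariant [MeasurableSpace G] [BorelSpace G]
    (μ : Measure G) [μ.IsHaarMeasure] [μ.InnerRegular] (V : Submodule ℂ H)
    [FiniteDimensional ℂ V] {K : Set G} (hK : IsCompact K) {ε : ℝ} (hε : 0 < ε) :
    ∃ (n : ℕ) (e : Fin n → H) (p : Fin n → ℝ), Orthonormal ℂ e ∧ (∀ i, e i ∈ Vᗮ) ∧
      (∀ i, 0 ≤ p i) ∧ ∑ i, p i = 1 ∧ ∀ k ∈ K, ∀ a : H →L[ℂ] H,
        ‖∑ i, (p i : ℂ) * inner ℂ (e i) (conjAct π k a (e i)) -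
          ∑ i, (p i : ℂ) * inner ℂ (e i) (a (e i))‖ ≤ ε * ‖a‖ := by
  obtain ⟨u, hu, hc, hu0, hu1, -⟩ := exists_density_support_subset μ (U := Set.univ) univ_mem
  have hP : φ (repAverage hπ μ hu hc V.starProjection) = 0 := by
    -- φ ∘ A is itself an invariant state, so `hmix` makes it vanish on rank one operators.
    have hrank : ∀ x y, φ.comp (repAverage hπ μ hu hc) (rankOne ℂ x y) = 0 := fun x y => by
      by_contra hne
      obtain ⟨W, hfin, hW0, hW⟩ := exists_invariant_submodule_of_apply_rankOne_ne_zero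
        (φ := φ.comp (repAverage hπ μ hu hc)) (π := π)
        (fun a ha => hφ0 _ (repAverage_nonneg hπ μ hu hc hu0 ha))
        (by rw [ContinuousLinearMap.comp_apply, repAverage_one hπ μ hu hc hu1, hφ1])
        (apply_repAverage_conjAct μ hπ hu hc hu1 hφ) hne
      exact hW0 (hmix W hfin hW)
    have := apply_starProjection_eq_sum (φ := φ.comp (repAverage hπ μ hu hc)) V
    rw [Finset.sum_eq_zero fun i _ => hrank _ _] at this
    exact this
  -- The bound 1/4 keeps the total mass m at least 1/2, as |1 − m| ≤ 2δ. Normalising doubles an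
  -- error of at most 2δ + δ² + 2δ ≤ 5δ, whence 10.
  set δ := min (1 / 4) (ε / 10) with hδ_def
  have hδ : 0 < δ := by positivity
  have hδ1 : δ ≤ 1 / 4 := min_le_left _ _
  have hδε : 10 * δ ≤ ε := by linarith [min_le_right (1 / 4) (ε / 10)]
  obtain ⟨ω, hω, hωP, hωK⟩ := exists_almost_invariant_finiteRankState hπ μ hu hc hu0 hu1 hφ0 hφ1 hφ
    hP hK (ε := δ ^ 2) (by positivity)
  obtain ⟨n, e, p, he, heV, hp, hpω⟩ := exists_weights_orthogonal hω V hδ.le hωP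
  set m := ∑ i, p i
  have hm : 1 / 2 ≤ m := by
    have h1 := hpω 1
    have h2 : ω 1 = 1 := by
      obtain ⟨ι, _, y, hy1, hy⟩ := exists_sum_inner_of_mem_finiteRankStates hω
      rw [hy]
      simp only [one_apply_eq_self, inner_self_eq_norm_sq_to_K]
      have h3 : (((∑ i, ‖y i‖ ^ 2 : ℝ)) : ℂ) = 1 := by rw [hy1, Complex.ofReal_one]
      rw [← h3, Complex.ofReal_sum]
      exact Finset.sum_congr rfl fun i _ => (Complex.ofReal_pow _ _).symm
    have h3 : ∑ i, (p i : ℂ) * inner ℂ (e i) ((1 : H →L[ℂ] H) (e i)) = (m : ℂ) := by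
      rw [Complex.ofReal_sum]
      refine Finset.sum_congr rfl fun i _ => ?_
      rw [one_apply_eq_self, inner_self_eq_norm_sq_to_K, he.1 i]
      simp
    have h4 : ‖(1 : H →L[ℂ] H)‖ ≤ 1 :=
      ContinuousLinearMap.opNorm_le_bound _ zero_le_one fun x => by simp
    rw [h2, h3] at h1
    have h5 : |1 - m| ≤ 2 * δ * 1 := by
      rw [← Real.norm_eq_abs, ← Complex.norm_real]
      push_cast
      exact h1.trans (by gcongr)
    have h6 := (abs_le.1 h5).2
    linarith
  have hm0 : 0 < m := by linarith
  refine ⟨n, e, fun i => m⁻¹ * p i, he, heV, fun i => mul_nonneg (inv_nonneg.2 hm0.le) (hp i),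
    by rw [← Finset.mul_sum, inv_mul_cancel₀ hm0.ne'], fun k hk a => ?_⟩
  have hscale : ∀ c : H →L[ℂ] H, ∑ i, ((m⁻¹ * p i : ℝ) : ℂ) * inner ℂ (e i) (c (e i)) =
      ((m⁻¹ : ℝ) : ℂ) * ∑ i, (p i : ℂ) * inner ℂ (e i) (c (e i)) := fun c => by
    rw [Finset.mul_sum]
    exact Finset.sum_congr rfl fun i _ => by rw [Complex.ofReal_mul, mul_assoc]
  rw [hscale, hscale, ← mul_sub, norm_mul, Complex.norm_real, Real.norm_of_nonneg
    (inv_nonneg.2 hm0.le)]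
  have h1 := hpω (conjAct π k a)
  have h2 := hpω a
  have h3 := hωK k hk a
  have h4 : 2 * δ * ‖conjAct π k a‖ ≤ 2 * δ * ‖a‖ :=
    mul_le_mul_of_nonneg_left (norm_conjAct_apply_le π _ _) (by positivity)
  have h5 : δ ^ 2 * ‖a‖ ≤ δ * ‖a‖ := by
    gcongr
    nlinarith
  have h6 : m⁻¹ ≤ 2 := by
    rw [inv_le_comm₀ hm0 two_pos]; linarith
  have h7 := dist_triangle4 (∑ i, (p i : ℂ) * inner ℂ (e i) (conjAct π k a (e i)))
    (ω (conjAct π k a)) (ω a) (∑ i, (p i : ℂ) * inner ℂ (e i) (a (e i)))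
  rw [dist_comm _ (ω (conjAct π k a))] at h7
  simp only [dist_eq_norm] at h7
  calc _ ≤ 2 * (5 * δ * ‖a‖) := by
        gcongr
        linarith
    _ = 10 * δ * ‖a‖ := by ring
    _ ≤ ε * ‖a‖ := by gcongr

/-- σ-compactness allows a sequence of stages: stage k is almost invariant, up to 1/(k + 1), on the
k-th set of a compact exhaustion. -/
lemma exists_invariant_charge_of_no_invariant_submodule [SigmaCompactSpace G] :
    ∃ X : Set H, IsOrthonormalBasis X ∧
      ∃ μ : ProbabilityCharge (Set X), IsRepInvariant π (inducedFunctional X μ) := by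
  classical
  borelize G
  have step : ∀ (F : Finset H) (k : ℕ), ∃ (n : ℕ) (e : Fin n → H) (p : Fin n → ℝ),
      Orthonormal ℂ e ∧ (∀ i, e i ∈ (Submodule.span ℂ (F : Set H))ᗮ) ∧
      (∀ i, 0 ≤ p i) ∧ ∑ i, p i = 1 ∧ ∀ g ∈ compactCovering G k, ∀ a : H →L[ℂ] H,
        ‖∑ i, (p i : ℂ) * inner ℂ (e i) (conjAct π g a (e i)) -
          ∑ i, (p i : ℂ) * inner ℂ (e i) (a (e i))‖ ≤ 1 / ((k : ℝ) + 1) * ‖a‖ := fun F k =>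
    exists_orthonormal_almost_invariant hπ hφ0 hφ1 hφ hmix Measure.haar _
      (isCompact_compactCovering G k) (by positivity)
  choose d e p he heF hp hp1 hinv using step
  -- `F k` collects all vectors chosen before stage k; the family of stage k is orthogonal to their
  -- span.
  let F : ℕ → Finset H := fun k =>
    Nat.rec ∅ (fun k F => F ∪ Finset.univ.image (e F k)) k
  have hFsucc : ∀ k, F (k + 1) = F k ∪ Finset.univ.image (e (F k) k) := fun k => rfl
  have hFmono : Monotone F := monotone_nat_of_le_succ fun k => by
    rw [hFsucc]; exact Finset.subset_union_left
  have hmem : ∀ k i, e (F k) k i ∈ F (k + 1) := fun k i => by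
    rw [hFsucc]
    exact Finset.mem_union_right _ (Finset.mem_image_of_mem _ (Finset.mem_univ i))
  have horth : ∀ k l i j, k < l → inner ℂ (e (F k) k i) (e (F l) l j) = 0 := fun k l i j hkl =>
    Submodule.inner_right_of_mem_orthogonal
      (Submodule.subset_span (hFmono (Nat.succ_le_of_lt hkl) (hmem k i))) (heF (F l) l j)
  let S : Set H := {x | ∃ k i, e (F k) k i = x}
  have hS : Orthonormal ℂ ((↑) : S → H) := by
    constructor
    · rintro ⟨_, k, i, rfl⟩
      exact (he (F k) k).1 i
    · rintro ⟨_, k, i, rfl⟩ ⟨_, l, j, rfl⟩ hne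
      rcases lt_trichotomy k l with h | rfl | h
      · exact horth k l i j h
      · exact (he (F k) k).2 fun hij => hne (by subst hij; rfl)
      · exact inner_eq_zero_symm.1 (horth l k j i h)
  refine exists_basis_invariant_charge hS (d := fun k => d (F k) k) (fun k => e (F k) k)
    (fun k i => ⟨k, i, rfl⟩) (fun k => p (F k) k) (fun k => hp (F k) k) (fun k => hp1 (F k) k)
    fun g a => ?_
  have hlim := (tendsto_one_div_add_atTop_nhds_zero_nat (𝕜 := ℝ)).mul_const ‖a‖
  rw [zero_mul] at hlim
  refine squeeze_zero_norm' ?_ hlim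
  obtain ⟨N, hN⟩ := exists_mem_compactCovering g
  filter_upwards [eventually_ge_atTop N] with k hk
  exact hinv (F k) k g (compactCovering_subset G hk hN) a

end WeaklyMixing

theorem theoremA {G : Type*} [Group G] [TopologicalSpace G] [IsTopologicalGroup G]
    [LocallyCompactSpace G] [SigmaCompactSpace G]
    {H : Type*} [NormedAddCommGroup H] [InnerProductSpace ℂ H] [CompleteSpace H]
    (π : G →* unitary (H →L[ℂ] H)) (hπ : IsStronglyContinuous π) :
    IsAmenableRep π ↔
      ∃ X : Set H, IsOrthonormalBasis X ∧
        ∃ μ : ProbabilityCharge (Set X), IsRepInvariant π (inducedFunctional X μ) := by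
  constructor
  · rintro ⟨φ, hφ1, hφ⟩
    by_cases hmix : ∀ W : Submodule ℂ H, FiniteDimensional ℂ W →
        (∀ g, ∀ w ∈ W, (π g : H →L[ℂ] H) w ∈ W) → W = ⊥
    · exact exists_invariant_charge_of_no_invariant_submodule hπ
        -- Positive functionals on B(H) are automatically continuous.
        (φ := ⟨φ.toLinearMap, map_continuous φ⟩) (fun a ha => φ.map_nonneg ha) hφ1
        ((isRepInvariant_iff π).1 hφ) hmix
    · push Not at hmix
      obtain ⟨W, hfin, hW, hW0⟩ := hmix
      exact exists_invariant_charge_of_invariant_submodule hfin hW0 hW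
  · rintro ⟨X, hX, μ, hμ⟩
    exact ⟨inducedState hX.1 μ, inducedState_one hX.1 μ, hμ⟩
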